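/- Let $\mathcal E$ be a locally cartesian closed category with finite limits, and let $\mathbb A$, $\mathbb B$ be internal categories in $\mathcal E$. For an object $I$ of $\mathcal E$ write $I^*\colon \mathcal E\to\mathcal E/I$ for the functor $X\mapsto (I\times X\to I)$; it preserves finite limits, so it also acts on internal categories, internal functors, internal natural transformations and cones. A diagram in an internal category $\mathbb C$ is an internal functor $D\colon\mathbb D\to\mathbb C$ from an internal category $\mathbb D$. A cone over $D$ consists of a vertex $V\colon\mathbb 1\to\mathbb C$ and an internal natural transformation from the constant diagram at $V$ to $D$. The cone is universal if, for every object $J$ of the ambient category, its image under $J^*$ is terminal in the (external) category of cones over $J^*D$. An internal category $\mathbb C$ in $\mathcal E$ is complete if, for every object $I$ of $\mathcal E$, every diagram $\mathbb D\to I^*\mathbb C$, with $\mathbb D$ any internal category in $\mathcal E/I$, has a universal cone. An internal functor $F\colon\mathbb C\to\mathbb C'$ is continuous if, for every object $I$ of $\mathcal E$ and every diagram $D\colon\mathbb D\to I^*\mathbb C$, the functor $I^*F$ sends each universal cone over $D$ to a universal cone over $(I^*F)D$. **Theorem (adjoint functor theorem).** Let $\mathbb B$ be a complete internal category in $\mathcal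 E$ and let $R\colon\mathbb B\to\mathbb A$ be a continuous internal functor. Then $R$ has a left adjoint: there are an internal functor $L\colon\mathbb A\to\mathbb B$ and internal natural transformations $\eta\colon \mathrm{Id}_{\mathbb A}\to RL$ and $\epsilon\colon LR\to\mathrm{Id}_{\mathbb B}$ such that $(\epsilon L)(L\eta)=\mathrm{Id}_L$ and $(R\epsilon)(\eta R)=\mathrm{Id}_R$. -/

import Mathlib

open CategoryTheory CategoryTheory.Limits

universe v u v' u'

noncomputable section

/-- A category with finite limits is locally cartesian closed if every pullback functor
`f^* : C/J ⥤ C/I` has a right adjoint (equivalently, every slice is cartesian closed). -/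
class IsLocallyCartesianClosed (C : Type u) [Category.{v} C] [HasFiniteLimits C] : Prop where
  isLeftAdjoint_pullback : ∀ {I J : C} (f : I ⟶ J), (Over.pullback f).IsLeftAdjoint

/-- An internal category in a category with finite limits. The domain of `comp` is the object of
pairs `(g, f)` with `src g = tgt f`. The last three axioms are stated for generalized
elements `X ⟶ Arr`. -/
structure InternalCategory (C : Type u) [Category.{v} C] [HasFiniteLimits C] where
  Obj : C
  Arr : C
  src : Arr ⟶ Obj
  tgt : Arr ⟶ Obj
  ident : Obj ⟶ Arr
  comp : pullback src tgt ⟶ Arr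
  ident_src : ident ≫ src = 𝟙 Obj
  ident_tgt : ident ≫ tgt = 𝟙 Obj
  comp_src : comp ≫ src = pullback.snd src tgt ≫ src
  comp_tgt : comp ≫ tgt = pullback.fst src tgt ≫ tgt
  assoc : ∀ {X : C} (h g f : X ⟶ Arr) (w : h ≫ src = g ≫ tgt) (w' : g ≫ src = f ≫ tgt),
    pullback.lift h (pullback.lift g f w' ≫ comp)
        (by rw [Category.assoc, comp_tgt, pullback.lift_fst_assoc, w]) ≫ comp =
      pullback.lift (pullback.lift h g w ≫ comp) f
        (by rw [Category.assoc, comp_src, pullback.lift_snd_assoc, w']) ≫ comp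
  comp_ident : ∀ {X : C} (f : X ⟶ Arr),
    pullback.lift f (f ≫ src ≫ ident)
      (by rw [Category.assoc, Category.assoc, ident_tgt, Category.comp_id]) ≫ comp = f
  ident_comp : ∀ {X : C} (f : X ⟶ Arr),
    pullback.lift (f ≫ tgt ≫ ident) f
      (by rw [Category.assoc, Category.assoc, ident_src, Category.comp_id]) ≫ comp = f

namespace InternalCategory

variable {C : Type u} [Category.{v} C] [HasFiniteLimits C]

/-- The composite `g ∘ f` of two composable generalized elements of the object of arrows. -/
def cmp (A : InternalCategory C) {X : C} (g f : X ⟶ A.Arr) (w : g ≫ A.src = f ≫ A.tgt) :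
    X ⟶ A.Arr :=
  pullback.lift g f w ≫ A.comp

lemma cmp_src (A : InternalCategory C) {X : C} (g f : X ⟶ A.Arr) (w : g ≫ A.src = f ≫ A.tgt) :
    A.cmp g f w ≫ A.src = f ≫ A.src := by
  rw [cmp, Category.assoc, A.comp_src, pullback.lift_snd_assoc]

lemma cmp_tgt (A : InternalCategory C) {X : C} (g f : X ⟶ A.Arr) (w : g ≫ A.src = f ≫ A.tgt) :
    A.cmp g f w ≫ A.tgt = g ≫ A.tgt := by
  rw [cmp, Category.assoc, A.comp_tgt, pullback.lift_fst_assoc]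

lemma comp_cmp (A : InternalCategory C) {X Y : C} (u : Y ⟶ X) (g f : X ⟶ A.Arr)
    (w : g ≫ A.src = f ≫ A.tgt) :
    u ≫ A.cmp g f w = A.cmp (u ≫ g) (u ≫ f) (by simp [w]) := by
  rw [cmp, cmp, ← Category.assoc]
  congr 1
  ext <;> simp [pullback.lift_fst, pullback.lift_snd]

lemma cmp_congr (A : InternalCategory C) {X : C} {g g' f f' : X ⟶ A.Arr}
    (w : g ≫ A.src = f ≫ A.tgt) (hg : g = g') (hf : f = f') :
    A.cmp g f w = A.cmp g' f' (by rw [← hg, ← hf, w]) := by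
  subst hg hf; rfl

lemma cmp_assoc (A : InternalCategory C) {X : C} (h g f : X ⟶ A.Arr)
    (w : h ≫ A.src = g ≫ A.tgt) (w' : g ≫ A.src = f ≫ A.tgt) :
    A.cmp h (A.cmp g f w') (by rw [cmp_tgt, w]) =
      A.cmp (A.cmp h g w) f (by rw [cmp_src, w']) :=
  A.assoc h g f w w'

lemma cmp_ident (A : InternalCategory C) {X : C} (f : X ⟶ A.Arr) :
    A.cmp f (f ≫ A.src ≫ A.ident) (by simp [A.ident_tgt]) = f :=
  A.comp_ident f

lemma ident_cmp (A : InternalCategory C) {X : C} (f : X ⟶ A.Arr) :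
    A.cmp (f ≫ A.tgt ≫ A.ident) f (by simp [A.ident_src]) = f :=
  A.ident_comp f

/-- The terminal internal category. -/
def terminal (C : Type u) [Category.{v} C] [HasFiniteLimits C] : InternalCategory C where
  Obj := ⊤_ C
  Arr := ⊤_ C
  src := 𝟙 _
  tgt := 𝟙 _
  ident := 𝟙 _
  comp := terminal.from _
  ident_src := terminal.hom_ext _ _
  ident_tgt := terminal.hom_ext _ _
  comp_src := terminal.hom_ext _ _
  comp_tgt := terminal.hom_ext _ _
  assoc _ _ _ _ _ := terminal.hom_ext _ _
  comp_ident _ := terminal.hom_ext _ _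
  ident_comp _ := terminal.hom_ext _ _

section Map

variable {C' : Type u'} [Category.{v'} C'] [HasFiniteLimits C']
  (Φ : C ⥤ C') [PreservesFiniteLimits Φ]

lemma lift_comp_iso_inv {P Q S T : C} (s : P ⟶ S) (t : Q ⟶ S) {X : C'} (k : X ⟶ Φ.obj T)
    (g : T ⟶ P) (f : T ⟶ Q) (w : g ≫ s = f ≫ t) {g' : X ⟶ Φ.obj P} {f' : X ⟶ Φ.obj Q}
    (w' : g' ≫ Φ.map s = f' ≫ Φ.map t) (hg : g' = k ≫ Φ.map g) (hf : f' = k ≫ Φ.map f) :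
    pullback.lift g' f' w' ≫ (PreservesPullback.iso Φ s t).inv =
      k ≫ Φ.map (pullback.lift g f w) := by
  subst hg hf
  rw [Iso.comp_inv_eq]
  ext
  · simp [pullback.lift_fst]
  · simp [pullback.lift_snd]

lemma exists_lift {P Q S : C} (s : P ⟶ S) (t : Q ⟶ S) {X : C'} (x : X ⟶ Φ.obj P)
    (y : X ⟶ Φ.obj Q) (w : x ≫ Φ.map s = y ≫ Φ.map t) :
    ∃ k : X ⟶ Φ.obj (pullback s t),
      k ≫ Φ.map (pullback.fst s t) = x ∧ k ≫ Φ.map (pullback.snd s t) = y :=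
  ⟨pullback.lift x y w ≫ (PreservesPullback.iso Φ s t).inv,
    by rw [Category.assoc, PreservesPullback.iso_inv_fst, pullback.lift_fst],
    by rw [Category.assoc, PreservesPullback.iso_inv_snd, pullback.lift_snd]⟩

/-- The image of an internal category under a functor that preserves finite limits, obtained by
applying the functor to the underlying diagram. -/
def map (A : InternalCategory C) : InternalCategory C' where
  Obj := Φ.obj A.Obj
  Arr := Φ.obj A.Arr
  src := Φ.map A.src
  tgt := Φ.map A.tgt
  ident := Φ.map A.ident
  comp := (PreservesPullback.iso Φ A.src A.tgt).inv ≫ Φ.map A.comp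
  ident_src := by rw [← Φ.map_comp, A.ident_src, Φ.map_id]
  ident_tgt := by rw [← Φ.map_comp, A.ident_tgt, Φ.map_id]
  comp_src := by
    rw [Category.assoc, ← Φ.map_comp, A.comp_src, Φ.map_comp, PreservesPullback.iso_inv_snd_assoc]
  comp_tgt := by
    rw [Category.assoc, ← Φ.map_comp, A.comp_tgt, Φ.map_comp, PreservesPullback.iso_inv_fst_assoc]
  assoc {X} h g f w w' := by
    let p := pullback.snd A.src A.tgt
    let q := pullback.fst A.src A.tgt
    have hpq : pullback.fst p q ≫ p = pullback.snd p q ≫ q := pullback.condition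
    have e₁ : (pullback.fst p q ≫ q) ≫ A.src = (pullback.fst p q ≫ p) ≫ A.tgt := by
      simp only [Category.assoc]; rw [pullback.condition]
    have e₂ : (pullback.fst p q ≫ p) ≫ A.src = (pullback.snd p q ≫ p) ≫ A.tgt := by
      rw [hpq]; simp only [Category.assoc]; rw [pullback.condition]
    obtain ⟨k₁, hk₁, hk₁'⟩ := exists_lift Φ A.src A.tgt h g w
    obtain ⟨k₂, hk₂, hk₂'⟩ := exists_lift Φ A.src A.tgt g f w'
    obtain ⟨k, hk, hk'⟩ := exists_lift Φ p q k₁ k₂ (hk₁'.trans hk₂.symm)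
    have hh : h = k ≫ Φ.map (pullback.fst p q ≫ q) := by
      rw [Φ.map_comp, ← Category.assoc, hk, hk₁]
    have hg : g = k ≫ Φ.map (pullback.fst p q ≫ p) := by
      rw [Φ.map_comp, ← Category.assoc, hk, hk₁']
    have hf : f = k ≫ Φ.map (pullback.snd p q ≫ p) := by
      rw [Φ.map_comp, ← Category.assoc, hk', hk₂']
    have key : ∀ {a b : pullback p q ⟶ A.Arr} (e : a ≫ A.src = b ≫ A.tgt) {a' b' : X ⟶ Φ.obj A.Arr}
        (e' : a' ≫ Φ.map A.src = b' ≫ Φ.map A.tgt) (ha : a' = k ≫ Φ.map a) (hb : b' = k ≫ Φ.map b),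
        pullback.lift a' b' e' ≫ (PreservesPullback.iso Φ A.src A.tgt).inv ≫ Φ.map A.comp =
          k ≫ Φ.map (A.cmp a b e) := by
      intro a b e a' b' e' ha hb
      rw [← Category.assoc, lift_comp_iso_inv Φ A.src A.tgt k a b e e' ha hb, Category.assoc,
        ← Φ.map_comp]
      rfl
    rw [key (by rw [cmp_tgt]; exact e₁) _ hh (key e₂ w' hg hf),
      key (by rw [cmp_src]; exact e₂) _ (key e₁ w hh hg) hf, cmp_assoc]
  comp_ident {X} f := by
    rw [← Category.assoc, lift_comp_iso_inv Φ A.src A.tgt f (𝟙 _) (A.src ≫ A.ident)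
      (by simp [A.ident_tgt]) _ (by simp) (by simp), Category.assoc, ← Φ.map_comp]
    have := A.cmp_ident (𝟙 _)
    simp only [cmp, Category.id_comp] at this
    rw [this, Φ.map_id, Category.comp_id]
  ident_comp {X} f := by
    rw [← Category.assoc, lift_comp_iso_inv Φ A.src A.tgt f (A.tgt ≫ A.ident) (𝟙 _)
      (by simp [A.ident_src]) _ (by simp) (by simp), Category.assoc, ← Φ.map_comp]
    have := A.ident_cmp (𝟙 _)
    simp only [cmp, Category.id_comp] at this
    rw [this, Φ.map_id, Category.comp_id]

lemma map_cmp (A : InternalCategory C) {X : C} (g f : X ⟶ A.Arr) (w : g ≫ A.src = f ≫ A.tgt) :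
    (A.map Φ).cmp (Φ.map g) (Φ.map f)
      (show Φ.map g ≫ Φ.map A.src = Φ.map f ≫ Φ.map A.tgt by
        rw [← Φ.map_comp, ← Φ.map_comp, w]) = Φ.map (A.cmp g f w) := by
  have h : Φ.map g ≫ Φ.map A.src = Φ.map f ≫ Φ.map A.tgt := by
    rw [← Φ.map_comp, ← Φ.map_comp, w]
  have := lift_comp_iso_inv Φ A.src A.tgt (𝟙 _) g f w h (by simp) (by simp)
  change pullback.lift (Φ.map g) (Φ.map f) h ≫
    (PreservesPullback.iso Φ A.src A.tgt).inv ≫ Φ.map A.comp = _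
  rw [← Category.assoc, this, Category.id_comp, ← Φ.map_comp]
  rfl

end Map

end InternalCategory

/-- An internal functor. -/
structure InternalFunctor {C : Type u} [Category.{v} C] [HasFiniteLimits C]
    (A B : InternalCategory C) where
  obj : A.Obj ⟶ B.Obj
  arr : A.Arr ⟶ B.Arr
  arr_src : arr ≫ B.src = A.src ≫ obj
  arr_tgt : arr ≫ B.tgt = A.tgt ≫ obj
  ident_arr : A.ident ≫ arr = obj ≫ B.ident
  cmp_arr : ∀ {X : C} (g f : X ⟶ A.Arr) (w : g ≫ A.src = f ≫ A.tgt),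
    A.cmp g f w ≫ arr = B.cmp (g ≫ arr) (f ≫ arr)
      (by rw [Category.assoc, Category.assoc, arr_src, arr_tgt, ← Category.assoc, w,
        Category.assoc])

namespace InternalFunctor

variable {C : Type u} [Category.{v} C] [HasFiniteLimits C]

/-- The identity internal functor. -/
def id (A : InternalCategory C) : InternalFunctor A A where
  obj := 𝟙 _
  arr := 𝟙 _
  arr_src := by simp
  arr_tgt := by simp
  ident_arr := by simp
  cmp_arr g f w := by
    rw [Category.comp_id]
    exact A.cmp_congr w (Category.comp_id g).symm (Category.comp_id f).symm

/-- The composite `G F` of internal functors, written in diagrammatic order. -/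
def comp {A B D : InternalCategory C} (F : InternalFunctor A B) (G : InternalFunctor B D) :
    InternalFunctor A D where
  obj := F.obj ≫ G.obj
  arr := F.arr ≫ G.arr
  arr_src := by rw [Category.assoc, G.arr_src, ← Category.assoc, F.arr_src, Category.assoc]
  arr_tgt := by rw [Category.assoc, G.arr_tgt, ← Category.assoc, F.arr_tgt, Category.assoc]
  ident_arr := by rw [← Category.assoc, F.ident_arr, Category.assoc, G.ident_arr, Category.assoc]
  cmp_arr g f w := by
    rw [← Category.assoc, F.cmp_arr g f w, G.cmp_arr]
    exact D.cmp_congr _ (Category.assoc _ _ _) (Category.assoc _ _ _)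

/-- The unique internal functor to the terminal internal category. -/
def toTerminal (A : InternalCategory C) : InternalFunctor A (InternalCategory.terminal C) where
  obj := terminal.from _
  arr := terminal.from _
  arr_src := terminal.hom_ext _ _
  arr_tgt := terminal.hom_ext _ _
  ident_arr := terminal.hom_ext _ _
  cmp_arr _ _ _ := terminal.hom_ext _ _

section Map

variable {C' : Type u'} [Category.{v'} C'] [HasFiniteLimits C']
  (Φ : C ⥤ C') [PreservesFiniteLimits Φ]

/-- The image of an internal functor under a functor that preserves finite limits. -/
def map {A B : InternalCategory C} (F : InternalFunctor A B) :
    InternalFunctor (A.map Φ) (B.map Φ) where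
  obj := Φ.map F.obj
  arr := Φ.map F.arr
  arr_src := by
    change Φ.map F.arr ≫ Φ.map B.src = Φ.map A.src ≫ Φ.map F.obj
    rw [← Φ.map_comp, F.arr_src, Φ.map_comp]
  arr_tgt := by
    change Φ.map F.arr ≫ Φ.map B.tgt = Φ.map A.tgt ≫ Φ.map F.obj
    rw [← Φ.map_comp, F.arr_tgt, Φ.map_comp]
  ident_arr := by
    change Φ.map A.ident ≫ Φ.map F.arr = Φ.map F.obj ≫ Φ.map B.ident
    rw [← Φ.map_comp, F.ident_arr, Φ.map_comp]
  cmp_arr {X} g f w := by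
    obtain ⟨k, hg', hf'⟩ := InternalCategory.exists_lift Φ A.src A.tgt g f w
    have hg : g = k ≫ Φ.map (pullback.fst A.src A.tgt) := hg'.symm
    have hf : f = k ≫ Φ.map (pullback.snd A.src A.tgt) := hf'.symm
    have e := F.cmp_arr _ _ (pullback.condition (f := A.src) (g := A.tgt))
    have e₁ : (A.map Φ).cmp g f w =
        k ≫ Φ.map (A.cmp _ _ (pullback.condition (f := A.src) (g := A.tgt))) :=
      ((A.map Φ).cmp_congr _ hg hf).trans (((A.map Φ).comp_cmp k _ _ _).symm.trans
        (congrArg (k ≫ ·) (A.map_cmp Φ _ _ pullback.condition)))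
    have e₂ := (B.map Φ).comp_cmp k _ _ (show
      Φ.map (pullback.fst A.src A.tgt ≫ F.arr) ≫ Φ.map B.src =
        Φ.map (pullback.snd A.src A.tgt ≫ F.arr) ≫ Φ.map B.tgt by
      rw [← Φ.map_comp, ← Φ.map_comp, Category.assoc, Category.assoc, F.arr_src, F.arr_tgt,
        pullback.condition_assoc])
    refine (congrArg (· ≫ Φ.map F.arr) e₁).trans ((Category.assoc _ _ _).trans ?_)
    refine (congrArg (k ≫ ·) ((Φ.map_comp _ _).symm.trans ((congrArg Φ.map e).trans
      (B.map_cmp Φ _ _ _).symm))).trans (e₂.trans ((B.map Φ).cmp_congr _ ?_ ?_))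
    · exact (congrArg (k ≫ ·) (Φ.map_comp _ _)).trans
        ((Category.assoc _ _ _).symm.trans (congrArg (· ≫ Φ.map F.arr) hg.symm))
    · exact (congrArg (k ≫ ·) (Φ.map_comp _ _)).trans
        ((Category.assoc _ _ _).symm.trans (congrArg (· ≫ Φ.map F.arr) hf.symm))

/-- The canonical internal functor from the terminal internal category to the image of the
terminal internal category (an isomorphism, since the given functor preserves finite limits). -/
def terminalToMap : InternalFunctor (InternalCategory.terminal C')
    ((InternalCategory.terminal C).map Φ) where
  obj := (PreservesTerminal.iso Φ).inv
  arr := (PreservesTerminal.iso Φ).inv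
  arr_src := (isLimitOfHasTerminalOfPreservesLimit Φ).hom_ext _ _
  arr_tgt := (isLimitOfHasTerminalOfPreservesLimit Φ).hom_ext _ _
  ident_arr := (isLimitOfHasTerminalOfPreservesLimit Φ).hom_ext _ _
  cmp_arr _ _ _ := (isLimitOfHasTerminalOfPreservesLimit Φ).hom_ext _ _

end Map

end InternalFunctor

/-- An internal natural transformation. -/
structure InternalNatTrans {C : Type u} [Category.{v} C] [HasFiniteLimits C]
    {A B : InternalCategory C} (F G : InternalFunctor A B) where
  app : A.Obj ⟶ B.Arr
  app_src : app ≫ B.src = F.obj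
  app_tgt : app ≫ B.tgt = G.obj
  naturality :
    B.cmp G.arr (A.src ≫ app) (by rw [G.arr_src, Category.assoc, app_tgt]) =
      B.cmp (A.tgt ≫ app) F.arr (by rw [F.arr_tgt, Category.assoc, app_src])

/-- An adjunction `L ⊣ R` of internal functors: a unit `Id ⟶ R L` and a counit `L R ⟶ Id`
that satisfy the triangle identities `(ε L) (L η) = Id` and `(R ε) (η R) = Id`. -/
structure InternalAdjunction {C : Type u} [Category.{v} C] [HasFiniteLimits C]
    {A B : InternalCategory C} (L : InternalFunctor A B) (R : InternalFunctor B A) where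
  unit : InternalNatTrans (InternalFunctor.id A) (L.comp R)
  counit : InternalNatTrans (R.comp L) (InternalFunctor.id B)
  left_triangle :
    B.cmp (L.obj ≫ counit.app) (unit.app ≫ L.arr)
      (by
        rw [Category.assoc, counit.app_src, Category.assoc, L.arr_tgt, ← Category.assoc unit.app,
          unit.app_tgt]
        simp [InternalFunctor.comp]) = L.obj ≫ B.ident
  right_triangle :
    A.cmp (counit.app ≫ R.arr) (R.obj ≫ unit.app)
      (by
        rw [Category.assoc, R.arr_src, ← Category.assoc, counit.app_src, Category.assoc,
          unit.app_tgt]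
        simp [InternalFunctor.comp]) = R.obj ≫ A.ident

/-- A cone over a diagram `F : D ⟶ A`: a vertex `V : 1 ⟶ A` and a natural transformation
`D ⟶ 1 ⟶ A` to `F` from the constant functor at `V` (that is, an arrow from the constant diagram
at `V` to `F` in the category of functors `D ⟶ A`). -/
structure InternalCone {C : Type u} [Category.{v} C] [HasFiniteLimits C]
    {D A : InternalCategory C} (F : InternalFunctor D A) where
  vertex : InternalFunctor (InternalCategory.terminal C) A
  leg : InternalNatTrans ((InternalFunctor.toTerminal D).comp vertex) F

namespace InternalCone

variable {C : Type u} [Category.{v} C] [HasFiniteLimits C]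

/-- A morphism of cones `c ⟶ c'`: a natural transformation of the vertices whose composite with
the legs of `c'` gives the legs of `c`. -/
structure Hom {D A : InternalCategory C} {F : InternalFunctor D A} (c c' : InternalCone F) where
  toNatTrans : InternalNatTrans c.vertex c'.vertex
  fac : A.cmp c'.leg.app ((InternalFunctor.toTerminal D).obj ≫ toNatTrans.app)
    (by rw [c'.leg.app_src, Category.assoc, toNatTrans.app_tgt]; rfl) = c.leg.app

/-- The cone `c` is terminal in the (external) category of cones over `F`. -/
def IsTerminal {D A : InternalCategory C} {F : InternalFunctor D A} (c : InternalCone F) : Prop :=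
  ∀ c' : InternalCone F, Nonempty (Unique (Hom c' c))

/-- The image of a cone over `F` under an internal functor `G`, a cone over `G F`. -/
def postcomp {D A B : InternalCategory C} {F : InternalFunctor D A} (c : InternalCone F)
    (G : InternalFunctor A B) : InternalCone (F.comp G) where
  vertex := c.vertex.comp G
  leg :=
    { app := c.leg.app ≫ G.arr
      app_src := by
        rw [Category.assoc, G.arr_src, ← Category.assoc, c.leg.app_src]
        simp [InternalFunctor.comp]
      app_tgt := by
        rw [Category.assoc, G.arr_tgt, ← Category.assoc, c.leg.app_tgt]
        simp [InternalFunctor.comp]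
      naturality := by
        have h := congrArg (· ≫ G.arr) c.leg.naturality
        simp only [G.cmp_arr] at h
        refine Eq.trans (B.cmp_congr _ rfl ?_) (h.trans (B.cmp_congr _ ?_ ?_))
        · rw [Category.assoc]
        · rw [Category.assoc]
        · simp [InternalFunctor.comp] }

/-- The image of a cone under a functor that preserves finite limits. -/
def map {C' : Type u'} [Category.{v'} C'] [HasFiniteLimits C'] (Φ : C ⥤ C')
    [PreservesFiniteLimits Φ] {D A : InternalCategory C} {F : InternalFunctor D A}
    (c : InternalCone F) : InternalCone (F.map Φ) where
  vertex := (InternalFunctor.terminalToMap Φ).comp (c.vertex.map Φ)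
  leg :=
    have hT : ∀ {X : C'} (a b : X ⟶ Φ.obj (⊤_ C)), a = b := fun a b =>
      (isLimitOfHasTerminalOfPreservesLimit Φ).hom_ext a b
    { app := Φ.map c.leg.app
      app_src := by
        change Φ.map c.leg.app ≫ Φ.map A.src = _
        rw [← Φ.map_comp, c.leg.app_src]
        exact (Φ.map_comp _ _).trans ((congrArg (· ≫ Φ.map c.vertex.obj) (hT _ _)).trans
          (Category.assoc _ _ _))
      app_tgt := by
        change Φ.map c.leg.app ≫ Φ.map A.tgt = _
        rw [← Φ.map_comp, c.leg.app_tgt]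
        rfl
      naturality := by
        have h := congrArg Φ.map c.leg.naturality
        rw [← InternalCategory.map_cmp, ← InternalCategory.map_cmp] at h
        refine Eq.trans ((A.map Φ).cmp_congr _ rfl ?_) (h.trans ((A.map Φ).cmp_congr _ ?_ ?_))
        · exact (Φ.map_comp _ _).symm
        · exact Φ.map_comp _ _
        · exact (Φ.map_comp _ _).trans ((congrArg (· ≫ Φ.map c.vertex.arr) (hT _ _)).trans
            (Category.assoc _ _ _)) }

end InternalCone

/-- The reindexing functor `I^* : C ⥤ C/I`, `X ↦ (I ⨯ X ⟶ I)`, preserves finite limits. -/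
instance preservesFiniteLimits_star {C : Type u} [Category.{v} C] [HasFiniteLimits C] (I : C) :
    PreservesFiniteLimits (Over.star I) :=
  haveI := (Over.forgetAdjStar I).rightAdjoint_preservesLimits
  PreservesLimits.preservesFiniteLimits _

/-- A cone is universal if, for every object `I`, its image under `I^*` is terminal among the
cones over the image of the diagram under `I^*`. -/
def InternalCone.IsUniversal {C : Type u} [Category.{v} C] [HasFiniteLimits C]
    {D A : InternalCategory C} {F : InternalFunctor D A} (c : InternalCone F) : Prop :=
  ∀ I : C, (c.map (Over.star I)).IsTerminal

/-- An internal category `A` is complete if, for every object `I`, every diagram over `I^* A`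
(of any shape internal to `C/I`) has a universal cone. -/
def InternalCategory.IsComplete {C : Type u} [Category.{v} C] [HasFiniteLimits C]
    (A : InternalCategory C) : Prop :=
  ∀ (I : C) (D : InternalCategory (Over I)) (F : InternalFunctor D (A.map (Over.star I))),
    ∃ c : InternalCone F, c.IsUniversal

/-- An internal functor `G : A ⟶ B` is continuous if, for every object `I`, the functor `I^* G`
sends each universal cone over a diagram in `I^* A` to a universal cone. -/
def InternalFunctor.IsContinuous {C : Type u} [Category.{v} C] [HasFiniteLimits C]
    {A B : InternalCategory C} (G : InternalFunctor A B) : Prop :=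
  ∀ (I : C) (D : InternalCategory (Over I)) (F : InternalFunctor D (A.map (Over.star I)))
    (c : InternalCone F), c.IsUniversal → (c.postcomp (G.map (Over.star I))).IsUniversal

end

/-!
The left adjoint sends an object `a` of `A` to the limit of the projection `(a ↓ R) ⟶ B` from the
comma category of arrows `f : a ⟶ R b`. Since `(a ↓ R)` is itself an internal category, this limit
exists without a solution set condition.

To treat all `a` at once, take `a` to be the generic object of `A`, the identity of `A.Obj`. Its
comma category `InternalFunctor.comma` lives in the slice over `A.Obj`, so completeness of `B` at
the stage `A.Obj` gives a universal cone, with vertex `L a` and legs `π_(f, b) : L a ⟶ b`.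
Continuity of `R` makes `R π_(f, b) : R L a ⟶ R b` a universal cone as well; the arrows
`f : a ⟶ R b` form a cone over the same diagram, and its factorization is an arrow
`η : a ⟶ R L a` with `R π_(f, b) ∘ η = f` (`exists_isComparison`).

Thus `(η, L a)` is an object of `(a ↓ R)`, and each leg `π_d` is an arrow of `(a ↓ R)` from it to
`d`. Naturality of the cone along `π_d` gives `π_d ∘ π_(η, L a) = π_d` for all `d`, hence
`π_(η, L a) = 1` because the legs of a limit are jointly monic (`leg_unitObj`). Naturality along an
arbitrary arrow `g` of `(a ↓ R)` from `(η, L a)` to `d` then gives `g = π_d` (`eq_leg`), so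
`(η, L a)` is initial in `(a ↓ R)`. A universal arrow from the generic object of `A` yields, by
uniqueness of factorizations, the functor `L`, the counit and the triangle identities
(`InternalUniversalArrows.adjunction`).

All computations use generalized elements. An element of `J^* A` at a stage `X` of the slice over
`J` transposes to an element of `A` at `X.left`, compatibly with composition
(`InternalCategory.arrEquiv_cmp`). This turns the definition of a universal cone, which speaks of
cones in all slices, into the usual universal property with respect to cones with a vertex at an
arbitrary stage (`InternalCone.IsUniversal.exists_factorization` and
`InternalCone.IsUniversal.hom_ext`).
-/

noncomputable section

/-! ### Generalized elements of reindexed categories -/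

namespace InternalCategory

variable {C : Type u} [Category.{v} C] [HasFiniteLimits C] {J : C}

/-- Objects of `J^* A` at stage `X : C/J` are objects of `A` at stage `X.left`. -/
def objEquiv (A : InternalCategory C) (X : Over J) :
    (X ⟶ (A.map (Over.star J)).Obj) ≃ (X.left ⟶ A.Obj) :=
  ((Over.forgetAdjStar J).homEquiv X A.Obj).symm

/-- Arrows of `J^* A` at stage `X : C/J` are arrows of `A` at stage `X.left`. -/
def arrEquiv (A : InternalCategory C) (X : Over J) :
    (X ⟶ (A.map (Over.star J)).Arr) ≃ (X.left ⟶ A.Arr) :=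
  ((Over.forgetAdjStar J).homEquiv X A.Arr).symm

section

variable (A B : InternalCategory C) {X Y : Over J}

lemma objEquiv_comp (u : Y ⟶ X) (a : X ⟶ (A.map (Over.star J)).Obj) :
    A.objEquiv Y (u ≫ a) = u.left ≫ A.objEquiv X a :=
  (Over.forgetAdjStar J).homEquiv_naturality_left_symm u a

lemma arrEquiv_comp (u : Y ⟶ X) (a : X ⟶ (A.map (Over.star J)).Arr) :
    A.arrEquiv Y (u ≫ a) = u.left ≫ A.arrEquiv X a :=
  (Over.forgetAdjStar J).homEquiv_naturality_left_symm u a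

lemma objEquiv_src (a : X ⟶ (A.map (Over.star J)).Arr) :
    A.objEquiv X (a ≫ (A.map (Over.star J)).src) = A.arrEquiv X a ≫ A.src :=
  (Over.forgetAdjStar J).homEquiv_naturality_right_symm a A.src

lemma objEquiv_tgt (a : X ⟶ (A.map (Over.star J)).Arr) :
    A.objEquiv X (a ≫ (A.map (Over.star J)).tgt) = A.arrEquiv X a ≫ A.tgt :=
  (Over.forgetAdjStar J).homEquiv_naturality_right_symm a A.tgt

lemma arrEquiv_ident (a : X ⟶ (A.map (Over.star J)).Obj) :
    A.arrEquiv X (a ≫ (A.map (Over.star J)).ident) = A.objEquiv X a ≫ A.ident :=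
  (Over.forgetAdjStar J).homEquiv_naturality_right_symm a A.ident

variable {A B} in
lemma objEquiv_map (F : InternalFunctor A B) (a : X ⟶ (A.map (Over.star J)).Obj) :
    B.objEquiv X (a ≫ (F.map (Over.star J)).obj) = A.objEquiv X a ≫ F.obj :=
  (Over.forgetAdjStar J).homEquiv_naturality_right_symm a F.obj

variable {A B} in
lemma arrEquiv_map (F : InternalFunctor A B) (a : X ⟶ (A.map (Over.star J)).Arr) :
    B.arrEquiv X (a ≫ (F.map (Over.star J)).arr) = A.arrEquiv X a ≫ F.arr :=
  (Over.forgetAdjStar J).homEquiv_naturality_right_symm a F.arr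

variable {A B} in
lemma arrEquiv_leg {F : InternalFunctor A B} (c : InternalCone F)
    (a : X ⟶ (A.map (Over.star J)).Obj) :
    B.arrEquiv X (a ≫ (c.map (Over.star J)).leg.app) = A.objEquiv X a ≫ c.leg.app :=
  (Over.forgetAdjStar J).homEquiv_naturality_right_symm a c.leg.app

lemma src_eq_tgt_of_arrEquiv {g f : X ⟶ (A.map (Over.star J)).Arr}
    (w : g ≫ (A.map (Over.star J)).src = f ≫ (A.map (Over.star J)).tgt) :
    A.arrEquiv X g ≫ A.src = A.arrEquiv X f ≫ A.tgt := by
  rw [← objEquiv_src, ← objEquiv_tgt, w]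

lemma arrEquiv_cmp (g f : X ⟶ (A.map (Over.star J)).Arr)
    (w : g ≫ (A.map (Over.star J)).src = f ≫ (A.map (Over.star J)).tgt) :
    A.arrEquiv X ((A.map (Over.star J)).cmp g f w) =
      A.cmp (A.arrEquiv X g) (A.arrEquiv X f) (A.src_eq_tgt_of_arrEquiv w) := by
  let adj := Over.forgetAdjStar J
  obtain ⟨k, hg, hf⟩ := exists_lift (Over.star J) A.src A.tgt g f w
  have h : (A.map (Over.star J)).cmp g f w = k ≫ (Over.star J).map A.comp := by
    have := lift_comp_iso_inv (Over.star J) A.src A.tgt k (pullback.fst _ _) (pullback.snd _ _)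
      pullback.condition w hg.symm hf.symm
    have e : pullback.lift (pullback.fst A.src A.tgt) (pullback.snd A.src A.tgt)
        pullback.condition = 𝟙 _ := by
      ext <;> simp
    rw [e, CategoryTheory.Functor.map_id, Category.comp_id] at this
    exact (Category.assoc _ _ _).symm.trans (congrArg (· ≫ _) this)
  have hg' : A.arrEquiv X g = (adj.homEquiv _ _).symm k ≫ pullback.fst A.src A.tgt :=
    (congrArg (A.arrEquiv X) hg.symm).trans (adj.homEquiv_naturality_right_symm k _)
  have hf' : A.arrEquiv X f = (adj.homEquiv _ _).symm k ≫ pullback.snd A.src A.tgt :=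
    (congrArg (A.arrEquiv X) hf.symm).trans (adj.homEquiv_naturality_right_symm k _)
  refine (congrArg (A.arrEquiv X) h).trans ((adj.homEquiv_naturality_right_symm k A.comp).trans
    (Eq.trans ?_ (A.cmp_congr _ hg' hf').symm))
  refine congrArg (· ≫ A.comp) ?_
  ext <;> simp [pullback.lift_fst, pullback.lift_snd]

end

/-- Composition with an identity on the right, with the identity given at an arbitrary object
propositionally equal to the source. -/
lemma cmp_ident_of_eq (A : InternalCategory C) {X : C} (f : X ⟶ A.Arr) (a : X ⟶ A.Obj)
    (w : f ≫ A.src = (a ≫ A.ident) ≫ A.tgt) : A.cmp f (a ≫ A.ident) w = f := by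
  obtain rfl : f ≫ A.src = a := by simpa [A.ident_tgt] using w
  exact (A.cmp_congr _ rfl (Category.assoc _ _ _)).trans (A.cmp_ident f)

/-- Composition with an identity on the left, with the identity given at an arbitrary object
propositionally equal to the target. -/
lemma ident_cmp_of_eq (A : InternalCategory C) {X : C} (f : X ⟶ A.Arr) (a : X ⟶ A.Obj)
    (w : (a ≫ A.ident) ≫ A.src = f ≫ A.tgt) : A.cmp (a ≫ A.ident) f w = f := by
  obtain rfl : a = f ≫ A.tgt := by simpa [A.ident_src] using w
  exact (A.cmp_congr _ (Category.assoc _ _ _) rfl).trans (A.ident_cmp f)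

lemma terminal_obj_ext {X : C} (a b : X ⟶ (terminal C).Obj) : a = b :=
  terminal.hom_ext _ _

lemma terminal_arr_ext {X : C} (a b : X ⟶ (terminal C).Arr) : a = b :=
  terminal.hom_ext _ _

/-- The unique object of the terminal internal category at stage `X`. -/
def toTerminalObj (X : C) : X ⟶ (terminal C).Obj :=
  terminal.from X

end InternalCategory

/-! ### Universal cones in terms of generalized elements -/

namespace InternalFunctor

variable {C : Type u} [Category.{v} C] [HasFiniteLimits C] {A : InternalCategory C}

lemma comp_obj {B D : InternalCategory C} (F : InternalFunctor B D) (G : InternalFunctor D A) :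
    (F.comp G).obj = F.obj ≫ G.obj :=
  rfl

lemma comp_arr {B D : InternalCategory C} (F : InternalFunctor B D) (G : InternalFunctor D A) :
    (F.comp G).arr = F.arr ≫ G.arr :=
  rfl

/-- The functor `1 ⟶ A` that picks out a global object of `A`. -/
def ofPoint (p : (InternalCategory.terminal C).Obj ⟶ A.Obj) :
    InternalFunctor (InternalCategory.terminal C) A where
  obj := p
  arr := (InternalCategory.terminal C).src ≫ p ≫ A.ident
  arr_src := by rw [Category.assoc, Category.assoc, A.ident_src, Category.comp_id]
  arr_tgt := by
    rw [Category.assoc, Category.assoc, A.ident_tgt, Category.comp_id]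
    exact congrArg (· ≫ p) (InternalCategory.terminal_obj_ext _ _)
  ident_arr := by rw [← Category.assoc, InternalCategory.ident_src, Category.id_comp]
  cmp_arr g f w := by
    have e : ∀ t : _ ⟶ (InternalCategory.terminal C).Arr,
        t ≫ (InternalCategory.terminal C).src ≫ p ≫ A.ident =
          ((g ≫ (InternalCategory.terminal C).src) ≫ p) ≫ A.ident := fun t => by
      rw [← Category.assoc, ← Category.assoc]
      exact congrArg (fun x => (x ≫ p) ≫ A.ident) (InternalCategory.terminal_obj_ext _ _)
    rw [A.cmp_congr _ (e g) (e f), A.cmp_ident_of_eq, e]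

lemma ofPoint_obj (p : (InternalCategory.terminal C).Obj ⟶ A.Obj) : (ofPoint p).obj = p :=
  rfl

lemma ofPoint_arr (p : (InternalCategory.terminal C).Obj ⟶ A.Obj) :
    (ofPoint p).arr = (InternalCategory.terminal C).src ≫ p ≫ A.ident :=
  rfl

/-- A functor out of `1` is determined by its action on the object, since every arrow of `1` is an
identity. -/
lemma arr_eq_obj_ident (V : InternalFunctor (InternalCategory.terminal C) A) :
    V.arr = (InternalCategory.terminal C).src ≫ V.obj ≫ A.ident := by
  rw [← V.ident_arr, ← Category.assoc]
  exact (Category.id_comp _).symm.trans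
    (congrArg (· ≫ V.arr) (InternalCategory.terminal_arr_ext _ _))

end InternalFunctor

namespace InternalNatTrans

variable {C : Type u} [Category.{v} C] [HasFiniteLimits C] {A : InternalCategory C}

/-- A natural transformation between functors `1 ⟶ A` is just a global arrow of `A`. -/
def ofPoint {V W : InternalFunctor (InternalCategory.terminal C) A}
    (p : (InternalCategory.terminal C).Obj ⟶ A.Arr)
    (hs : p ≫ A.src = V.obj) (ht : p ≫ A.tgt = W.obj) : InternalNatTrans V W where
  app := p
  app_src := hs
  app_tgt := ht
  naturality := by
    have e : (InternalCategory.terminal C).tgt ≫ p = (InternalCategory.terminal C).src ≫ p :=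
      congrArg (· ≫ p) (InternalCategory.terminal_obj_ext _ _)
    have e₁ := W.arr_eq_obj_ident.trans (Category.assoc _ _ _).symm
    have e₂ := V.arr_eq_obj_ident.trans (Category.assoc _ _ _).symm
    rw [A.cmp_congr _ e₁ rfl, A.cmp_congr _ e e₂, A.cmp_ident_of_eq, A.ident_cmp_of_eq]

end InternalNatTrans

namespace InternalCone

variable {C : Type u} [Category.{v} C] [HasFiniteLimits C] {D A : InternalCategory C}
  {F : InternalFunctor D A}

/-- A cone over `F` at stage `J`, that is, a cone over `J^* F` presented by generalized elements:
a vertex `J ⟶ A.Obj` and, by the Yoneda lemma, a leg `X ⟶ A.Arr` for each stage `j : X ⟶ J` and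
each object `d` of `D` at stage `X`, natural in `X` and in `d`. -/
structure Staged (F : InternalFunctor D A) (J : C) where
  vertex : J ⟶ A.Obj
  leg : ∀ {X : C} (_ : X ⟶ J) (_ : X ⟶ D.Obj), X ⟶ A.Arr
  comp_leg : ∀ {X Y : C} (u : Y ⟶ X) (j : X ⟶ J) (d : X ⟶ D.Obj),
    u ≫ leg j d = leg (u ≫ j) (u ≫ d)
  leg_src : ∀ {X : C} (j : X ⟶ J) (d : X ⟶ D.Obj), leg j d ≫ A.src = j ≫ vertex
  leg_tgt : ∀ {X : C} (j : X ⟶ J) (d : X ⟶ D.Obj), leg j d ≫ A.tgt = d ≫ F.obj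
  naturality : ∀ {X : C} (j : X ⟶ J) (δ : X ⟶ D.Arr),
    A.cmp (δ ≫ F.arr) (leg j (δ ≫ D.src))
      (by rw [leg_tgt, Category.assoc, F.arr_src, Category.assoc]) = leg j (δ ≫ D.tgt)

/-- The object of `A` at stage `J` given by the vertex of a cone. -/
def vertexAt (c : InternalCone F) (J : C) : J ⟶ A.Obj :=
  InternalCategory.toTerminalObj J ≫ c.vertex.obj

lemma comp_vertexAt (c : InternalCone F) {J K : C} (u : K ⟶ J) :
    u ≫ c.vertexAt J = c.vertexAt K := by
  rw [vertexAt, vertexAt, ← Category.assoc]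
  exact congrArg (· ≫ c.vertex.obj) (InternalCategory.terminal_obj_ext _ _)

lemma leg_app_src (c : InternalCone F) {X : C} (d : X ⟶ D.Obj) :
    (d ≫ c.leg.app) ≫ A.src = c.vertexAt X := by
  rw [Category.assoc, c.leg.app_src, vertexAt, InternalFunctor.comp_obj, ← Category.assoc]
  exact congrArg (· ≫ c.vertex.obj) (InternalCategory.terminal_obj_ext _ _)

lemma leg_app_tgt (c : InternalCone F) {X : C} (d : X ⟶ D.Obj) :
    (d ≫ c.leg.app) ≫ A.tgt = d ≫ F.obj := by
  rw [Category.assoc, c.leg.app_tgt]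

/-- The leg of a cone at the target of an arrow of the shape is the composite of the leg at its
source with the image of the arrow. -/
lemma cmp_leg (c : InternalCone F) {X : C} (δ : X ⟶ D.Arr) :
    A.cmp (δ ≫ F.arr) ((δ ≫ D.src) ≫ c.leg.app)
      (by rw [leg_app_tgt, Category.assoc, F.arr_src, Category.assoc]) =
      (δ ≫ D.tgt) ≫ c.leg.app := by
  have h := congrArg (δ ≫ ·) c.leg.naturality
  simp only [A.comp_cmp] at h
  have e : δ ≫ ((InternalFunctor.toTerminal D).comp c.vertex).arr = c.vertexAt X ≫ A.ident := by
    simp only [InternalFunctor.comp_arr, c.vertex.arr_eq_obj_ident, vertexAt, ← Category.assoc]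
    exact congrArg (fun x => (x ≫ c.vertex.obj) ≫ A.ident) (InternalCategory.terminal_obj_ext _ _)
  refine Eq.trans (A.cmp_congr _ rfl (Category.assoc _ _ _)) (h.trans ?_)
  rw [A.cmp_congr _ (Category.assoc δ D.tgt c.leg.app).symm e, A.cmp_ident_of_eq]

/-- The object of objects of the terminal internal category in `C/J`. -/
abbrev one (J : C) : Over J :=
  (InternalCategory.terminal (Over J)).Obj

/-- The isomorphism between two terminal objects of `C/J`, the identity of `J` and `one J`. -/
abbrev toOneOver (J : C) : Over.mk (𝟙 J) ⟶ one J :=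
  InternalCategory.toTerminalObj _

/-- The cone over `J^* F` presented by a cone at stage `J`. -/
def Staged.toCone {J : C} (s : Staged F J) : InternalCone (F.map (Over.star J)) where
  vertex := .ofPoint ((A.objEquiv _).symm ((one J).hom ≫ s.vertex))
  leg :=
    { app := (A.arrEquiv (D.map (Over.star J)).Obj).symm
        (s.leg (D.map (Over.star J)).Obj.hom (D.objEquiv _ (𝟙 _)))
      app_src := by
        apply (A.objEquiv _).injective
        rw [A.objEquiv_src, Equiv.apply_symm_apply, s.leg_src]
        rw [InternalFunctor.comp_obj, InternalFunctor.ofPoint_obj, A.objEquiv_comp,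
          Equiv.apply_symm_apply, Over.w_assoc]
      app_tgt := by
        apply (A.objEquiv _).injective
        rw [A.objEquiv_tgt, Equiv.apply_symm_apply, s.leg_tgt, ← InternalCategory.objEquiv_map,
          Category.id_comp]
      naturality := by
        apply (A.arrEquiv _).injective
        rw [A.arrEquiv_cmp, A.arrEquiv_cmp]
        have h := s.naturality (D.map (Over.star J)).Arr.hom (D.arrEquiv _ (𝟙 _))
        have key : ∀ t : (D.map (Over.star J)).Arr ⟶ (D.map (Over.star J)).Obj,
            A.arrEquiv _ (t ≫ (A.arrEquiv (D.map (Over.star J)).Obj).symm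
              (s.leg (D.map (Over.star J)).Obj.hom (D.objEquiv _ (𝟙 _)))) =
            s.leg (D.map (Over.star J)).Arr.hom (D.objEquiv _ t) := by
          intro t
          rw [A.arrEquiv_comp, Equiv.apply_symm_apply, s.comp_leg, Over.w, ← D.objEquiv_comp,
            Category.comp_id]
        have e₁ : A.arrEquiv _ (F.map (Over.star J)).arr = D.arrEquiv _ (𝟙 _) ≫ F.arr := by
          rw [← InternalCategory.arrEquiv_map, Category.id_comp]
        have e₂ : A.arrEquiv _ ((InternalFunctor.toTerminal (D.map (Over.star J))).comp
            (.ofPoint ((A.objEquiv _).symm ((one J).hom ≫ s.vertex)))).arr =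
            ((D.map (Over.star J)).Arr.hom ≫ s.vertex) ≫ A.ident := by
          rw [InternalFunctor.comp_arr, InternalFunctor.ofPoint_arr, ← Category.assoc,
            ← Category.assoc, A.arrEquiv_ident, A.objEquiv_comp, Equiv.apply_symm_apply,
            Over.w_assoc]
        have e₃ : D.objEquiv _ (D.map (Over.star J)).src = D.arrEquiv _ (𝟙 _) ≫ D.src := by
          rw [← D.objEquiv_src, Category.id_comp]
        have e₄ : D.objEquiv _ (D.map (Over.star J)).tgt = D.arrEquiv _ (𝟙 _) ≫ D.tgt := by
          rw [← D.objEquiv_tgt, Category.id_comp]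
        -- The naturality square reduces to naturality of `s` at the generic arrow of `D`.
        rw [A.cmp_congr _ e₁ ((key _).trans (congrArg _ e₃)), A.cmp_congr _ (key _) e₂,
          A.cmp_ident_of_eq, h, e₄] }

/-- The vertex of `J^* c` is the vertex of `c`, taken at the stage of the terminal object of
`C/J`. -/
lemma map_vertex_obj (c : InternalCone F) (J : C) :
    A.objEquiv _ (c.map (Over.star J)).vertex.obj = c.vertexAt _ :=
  ((Over.forgetAdjStar J).homEquiv_naturality_right_symm _ c.vertex.obj).trans
    (congrArg (· ≫ c.vertex.obj) (InternalCategory.terminal_obj_ext _ _))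

/-- `h` is the factorization through `c` of a cone at stage `J`. -/
structure IsFactorization (c : InternalCone F) {J : C} (s : Staged F J) (h : J ⟶ A.Arr) :
    Prop where
  src : h ≫ A.src = s.vertex
  tgt : h ≫ A.tgt = c.vertexAt J
  fac : ∀ {X : C} (j : X ⟶ J) (d : X ⟶ D.Obj),
    A.cmp (d ≫ c.leg.app) (j ≫ h)
      (by rw [leg_app_src, Category.assoc, tgt, comp_vertexAt]) = s.leg j d

/-- Together with `hom_fromTerminal`: the domain of the terminal object of `C/J` is isomorphic to
`J`, by its structure map. -/
lemma fromTerminal_hom (J : C) : (toOneOver J).left ≫ (one J).hom = 𝟙 J :=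
  Over.w (toOneOver J)

lemma hom_fromTerminal (J : C) :
    (one J).hom ≫ (toOneOver J).left = 𝟙 (one J).left :=
  congrArg (fun f => f.left) (InternalCategory.terminal_obj_ext
    ((Over.homMk (one J).hom : one J ⟶ Over.mk (𝟙 J)) ≫ toOneOver J) (𝟙 _))

/-- A factorization at stage `J` is a morphism of cones over `J^* F`. -/
def IsFactorization.toHom {c : InternalCone F} {J : C} {s : Staged F J} {h : J ⟶ A.Arr}
    (H : c.IsFactorization s h) : Hom s.toCone (c.map (Over.star J)) where
  toNatTrans := .ofPoint ((A.arrEquiv _).symm ((one J).hom ≫ h))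
    (by
      apply (A.objEquiv _).injective
      rw [A.objEquiv_src, Equiv.apply_symm_apply, Category.assoc, H.src]
      exact (Equiv.apply_symm_apply _ _).symm)
    (by
      apply (A.objEquiv _).injective
      rw [A.objEquiv_tgt, Equiv.apply_symm_apply, Category.assoc, H.tgt, comp_vertexAt]
      exact (c.map_vertex_obj J).symm)
  fac := by
    apply (A.arrEquiv _).injective
    rw [A.arrEquiv_cmp]
    have e₁ : A.arrEquiv _ (c.map (Over.star J)).leg.app = D.objEquiv _ (𝟙 _) ≫ c.leg.app := by
      rw [← InternalCategory.arrEquiv_leg, Category.id_comp]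
    have e₂ : A.arrEquiv _ ((InternalFunctor.toTerminal (D.map (Over.star J))).obj ≫
        (A.arrEquiv _).symm ((one J).hom ≫ h)) = (D.map (Over.star J)).Obj.hom ≫ h := by
      rw [A.arrEquiv_comp, Equiv.apply_symm_apply, Over.w_assoc]
    refine (A.cmp_congr _ e₁ e₂).trans ((H.fac _ _).trans ?_)
    exact (Equiv.apply_symm_apply _ _).symm

/-- A morphism of cones over `J^* F` is a factorization at stage `J`. -/
lemma isFactorization_of_hom {c : InternalCone F} {J : C} {s : Staged F J}
    (k : Hom s.toCone (c.map (Over.star J))) :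
    c.IsFactorization s ((toOneOver J).left ≫ A.arrEquiv _ k.toNatTrans.app) := by
  have e : (D.map (Over.star J)).Obj.hom ≫ (toOneOver J).left =
      (InternalFunctor.toTerminal (D.map (Over.star J))).obj.left := by
    rw [← Over.w (InternalFunctor.toTerminal (D.map (Over.star J))).obj, Category.assoc,
      hom_fromTerminal, Category.comp_id]
  have hs : ((toOneOver J).left ≫ A.arrEquiv _ k.toNatTrans.app) ≫ A.src =
      s.vertex := by
    rw [Category.assoc, ← A.objEquiv_src, k.toNatTrans.app_src]
    change _ ≫ A.objEquiv _ ((A.objEquiv _).symm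
      ((one J).hom ≫ s.vertex)) = _
    rw [Equiv.apply_symm_apply, ← Category.assoc, fromTerminal_hom]
    exact Category.id_comp s.vertex
  have ht : ((toOneOver J).left ≫ A.arrEquiv _ k.toNatTrans.app) ≫ A.tgt =
      c.vertexAt J := by
    rw [Category.assoc, ← A.objEquiv_tgt, k.toNatTrans.app_tgt, map_vertex_obj]
    exact c.comp_vertexAt _
  refine ⟨hs, ht, fun {X} j d => ?_⟩
  have h := congrArg (A.arrEquiv _) k.fac
  rw [A.arrEquiv_cmp] at h
  let m : Over.mk j ⟶ (D.map (Over.star J)).Obj := (D.objEquiv (Over.mk j)).symm d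
  have h' := congrArg (m.left ≫ ·) h
  simp only [A.comp_cmp] at h'
  have hm : m.left ≫ D.objEquiv _ (𝟙 _) = d := by
    rw [← D.objEquiv_comp, Category.comp_id]
    exact Equiv.apply_symm_apply _ _
  have hj : m.left ≫ (D.map (Over.star J)).Obj.hom = j := Over.w m
  refine (A.cmp_congr _ ?_ ?_).trans (h'.trans ?_)
  · rw [← hm, Category.assoc, ← InternalCategory.arrEquiv_leg, Category.id_comp]
  · rw [A.arrEquiv_comp, ← e]
    refine (congrArg (· ≫ _) hj.symm).trans ?_
    simp only [Category.assoc]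
  · change _ ≫ A.arrEquiv _ ((A.arrEquiv _).symm _) = _
    rw [Equiv.apply_symm_apply, s.comp_leg, hm, hj]

/-- A universal cone has the universal property of a limit with respect to the cones at each
stage. -/
lemma IsUniversal.exists_factorization {c : InternalCone F} (hc : c.IsUniversal) {J : C}
    (s : Staged F J) : ∃ h, c.IsFactorization s h := by
  obtain ⟨k⟩ := hc J s.toCone
  exact ⟨_, isFactorization_of_hom k.default⟩

/-- Factorizations through a universal cone are unique. -/
lemma IsUniversal.factorization_unique {c : InternalCone F} (hc : c.IsUniversal) {J : C}
    {s : Staged F J} {h h' : J ⟶ A.Arr} (H : c.IsFactorization s h)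
    (H' : c.IsFactorization s h') : h = h' := by
  obtain ⟨k⟩ := hc J s.toCone
  have e : (one J).hom ≫ h = (one J).hom ≫ h' :=
    (A.arrEquiv _).symm.injective (congrArg (fun m => m.toNatTrans.app)
      ((k.uniq H.toHom).trans (k.uniq H'.toHom).symm))
  have := congrArg ((toOneOver J).left ≫ ·) e
  simp only [← Category.assoc, fromTerminal_hom] at this
  exact (Category.id_comp h).symm.trans (this.trans (Category.id_comp h'))

/-- The cone at stage `J` obtained from `c` by precomposition with an arrow into its vertex. -/
def staged (c : InternalCone F) {J : C} (h : J ⟶ A.Arr) (ht : h ≫ A.tgt = c.vertexAt J) :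
    Staged F J where
  vertex := h ≫ A.src
  leg j d := A.cmp (d ≫ c.leg.app) (j ≫ h)
    (by rw [leg_app_src, Category.assoc, ht, comp_vertexAt])
  comp_leg u j d := by
    rw [A.comp_cmp]
    exact A.cmp_congr _ (Category.assoc _ _ _).symm (Category.assoc _ _ _).symm
  leg_src j d := by rw [A.cmp_src, Category.assoc]
  leg_tgt j d := by rw [A.cmp_tgt, leg_app_tgt]
  naturality j δ := by
    rw [A.cmp_assoc]
    exact A.cmp_congr _ (c.cmp_leg δ) rfl

/-- Two arrows into the vertex of a universal cone are equal if they have the same source and the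
same composites with the legs. -/
lemma IsUniversal.hom_ext {c : InternalCone F} (hc : c.IsUniversal) {J : C} {h h' : J ⟶ A.Arr}
    (ht : h ≫ A.tgt = c.vertexAt J) (ht' : h' ≫ A.tgt = c.vertexAt J)
    (hs : h ≫ A.src = h' ≫ A.src)
    (hl : ∀ {X : C} (j : X ⟶ J) (d : X ⟶ D.Obj),
      A.cmp (d ≫ c.leg.app) (j ≫ h)
        (by rw [leg_app_src, Category.assoc, ht, comp_vertexAt]) =
      A.cmp (d ≫ c.leg.app) (j ≫ h')
        (by rw [leg_app_src, Category.assoc, ht', comp_vertexAt])) : h = h' :=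
  hc.factorization_unique (s := c.staged h ht) ⟨rfl, ht, fun _ _ => rfl⟩
    ⟨hs.symm, ht', fun j d => (hl j d).symm⟩

end InternalCone

/-! ### The generic comma category -/

namespace InternalFunctor

variable {C : Type u} [Category.{v} C] [HasFiniteLimits C] {A B : InternalCategory C}
  (R : InternalFunctor B A)

/-- The object of pairs `(f, b)` with `f : a ⟶ R b`, indexed by `a`. -/
def commaObj : Over A.Obj :=
  Over.mk (pullback.fst A.tgt R.obj ≫ A.src)

/-- The object of pairs `(f, g)` with `f : a ⟶ R b` and `g : b ⟶ b'`, indexed by `a`. Such a pair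
is an arrow from `(f, b)` to `(R g ∘ f, b')`. -/
def commaArr : Over A.Obj :=
  Over.mk (pullback.fst A.tgt (B.src ≫ R.obj) ≫ A.src)

namespace commaObj

variable {R} {X Y : Over A.Obj}

/-- The arrow of `A` that underlies an object of the comma category. -/
def hom (d : X ⟶ R.commaObj) : X.left ⟶ A.Arr :=
  d.left ≫ pullback.fst A.tgt R.obj

/-- The object of `B` that underlies an object of the comma category. -/
def right (d : X ⟶ R.commaObj) : X.left ⟶ B.Obj :=
  d.left ≫ pullback.snd A.tgt R.obj

lemma hom_src (d : X ⟶ R.commaObj) : hom d ≫ A.src = X.hom :=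
  (Category.assoc _ _ _).trans (Over.w d)

lemma hom_tgt (d : X ⟶ R.commaObj) : hom d ≫ A.tgt = right d ≫ R.obj :=
  (Category.assoc _ _ _).trans ((congrArg (d.left ≫ ·) pullback.condition).trans
    (Category.assoc _ _ _).symm)

lemma hom_comp (u : Y ⟶ X) (d : X ⟶ R.commaObj) : hom (u ≫ d) = u.left ≫ hom d :=
  Category.assoc _ _ _

lemma right_comp (u : Y ⟶ X) (d : X ⟶ R.commaObj) : right (u ≫ d) = u.left ≫ right d :=
  Category.assoc _ _ _

lemma ext {d d' : X ⟶ R.commaObj} (h : hom d = hom d') (h' : right d = right d') : d = d' :=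
  Over.OverMorphism.ext (pullback.hom_ext h h')

/-- The object of the comma category given by an arrow `f : a ⟶ R b`. -/
def mk (f : X.left ⟶ A.Arr) (b : X.left ⟶ B.Obj) (hf : f ≫ A.src = X.hom)
    (w : f ≫ A.tgt = b ≫ R.obj) : X ⟶ R.commaObj :=
  Over.homMk (pullback.lift f b w) ((pullback.lift_fst_assoc _ _ _ _).trans hf)

lemma hom_mk (f : X.left ⟶ A.Arr) (b : X.left ⟶ B.Obj) (hf : f ≫ A.src = X.hom)
    (w : f ≫ A.tgt = b ≫ R.obj) : hom (mk f b hf w) = f :=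
  pullback.lift_fst _ _ _

lemma right_mk (f : X.left ⟶ A.Arr) (b : X.left ⟶ B.Obj) (hf : f ≫ A.src = X.hom)
    (w : f ≫ A.tgt = b ≫ R.obj) : right (mk f b hf w) = b :=
  pullback.lift_snd _ _ _

end commaObj

namespace commaArr

variable {R} {X Y : Over A.Obj}

/-- The arrow of `A` that underlies the source of an arrow of the comma category. -/
def hom (δ : X ⟶ R.commaArr) : X.left ⟶ A.Arr :=
  δ.left ≫ pullback.fst A.tgt (B.src ≫ R.obj)

/-- The arrow of `B` that underlies an arrow of the comma category. -/
def right (δ : X ⟶ R.commaArr) : X.left ⟶ B.Arr :=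
  δ.left ≫ pullback.snd A.tgt (B.src ≫ R.obj)

lemma hom_src (δ : X ⟶ R.commaArr) : hom δ ≫ A.src = X.hom :=
  (Category.assoc _ _ _).trans (Over.w δ)

lemma hom_tgt (δ : X ⟶ R.commaArr) : hom δ ≫ A.tgt = (right δ ≫ B.src) ≫ R.obj :=
  (Category.assoc _ _ _).trans ((congrArg (δ.left ≫ ·) pullback.condition).trans
    ((Category.assoc _ _ _).symm.trans (Category.assoc _ _ _).symm))

lemma right_arr_src (δ : X ⟶ R.commaArr) :
    (right δ ≫ R.arr) ≫ A.src = hom δ ≫ A.tgt := by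
  rw [hom_tgt, Category.assoc, R.arr_src, Category.assoc]

lemma hom_comp (u : Y ⟶ X) (δ : X ⟶ R.commaArr) : hom (u ≫ δ) = u.left ≫ hom δ :=
  Category.assoc _ _ _

lemma right_comp (u : Y ⟶ X) (δ : X ⟶ R.commaArr) : right (u ≫ δ) = u.left ≫ right δ :=
  Category.assoc _ _ _

lemma ext {δ δ' : X ⟶ R.commaArr} (h : hom δ = hom δ') (h' : right δ = right δ') : δ = δ' :=
  Over.OverMorphism.ext (pullback.hom_ext h h')

/-- The arrow of the comma category given by `f : a ⟶ R b` and `g : b ⟶ b'`. -/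
def mk (f : X.left ⟶ A.Arr) (g : X.left ⟶ B.Arr) (hf : f ≫ A.src = X.hom)
    (w : f ≫ A.tgt = (g ≫ B.src) ≫ R.obj) : X ⟶ R.commaArr :=
  Over.homMk (pullback.lift f g (w.trans (Category.assoc _ _ _)))
    ((pullback.lift_fst_assoc _ _ _ _).trans hf)

lemma hom_mk (f : X.left ⟶ A.Arr) (g : X.left ⟶ B.Arr) (hf : f ≫ A.src = X.hom)
    (w : f ≫ A.tgt = (g ≫ B.src) ≫ R.obj) : hom (mk f g hf w) = f :=
  pullback.lift_fst _ _ _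

lemma right_mk (f : X.left ⟶ A.Arr) (g : X.left ⟶ B.Arr) (hf : f ≫ A.src = X.hom)
    (w : f ≫ A.tgt = (g ≫ B.src) ≫ R.obj) : right (mk f g hf w) = g :=
  pullback.lift_snd _ _ _

end commaArr

/-- The source map of the comma category. -/
def commaSrc : R.commaArr ⟶ R.commaObj :=
  commaObj.mk (commaArr.hom (𝟙 _)) (commaArr.right (𝟙 _) ≫ B.src) (commaArr.hom_src _)
    (commaArr.hom_tgt _)

/-- The target map of the comma category. -/
def commaTgt : R.commaArr ⟶ R.commaObj :=
  commaObj.mk (A.cmp (commaArr.right (𝟙 _) ≫ R.arr) (commaArr.hom (𝟙 _))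
      (commaArr.right_arr_src _)) (commaArr.right (𝟙 _) ≫ B.tgt)
    (by rw [A.cmp_src, commaArr.hom_src])
    (by rw [A.cmp_tgt, Category.assoc, R.arr_tgt, Category.assoc])

/-- The map of identities of the comma category. -/
def commaIdent : R.commaObj ⟶ R.commaArr :=
  commaArr.mk (commaObj.hom (𝟙 _)) (commaObj.right (𝟙 _) ≫ B.ident) (commaObj.hom_src _)
    (by rw [Category.assoc _ B.ident, B.ident_src, Category.comp_id, commaObj.hom_tgt])

section

variable {R} {X : Over A.Obj}

lemma hom_commaSrc (δ : X ⟶ R.commaArr) : commaObj.hom (δ ≫ R.commaSrc) = commaArr.hom δ := by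
  rw [commaObj.hom_comp, commaSrc, commaObj.hom_mk, ← commaArr.hom_comp, Category.comp_id]

lemma right_commaSrc (δ : X ⟶ R.commaArr) :
    commaObj.right (δ ≫ R.commaSrc) = commaArr.right δ ≫ B.src := by
  rw [commaObj.right_comp, commaSrc, commaObj.right_mk, ← Category.assoc, ← commaArr.right_comp,
    Category.comp_id]

lemma hom_commaTgt (δ : X ⟶ R.commaArr) :
    commaObj.hom (δ ≫ R.commaTgt) =
      A.cmp (commaArr.right δ ≫ R.arr) (commaArr.hom δ) (commaArr.right_arr_src δ) := by
  rw [commaObj.hom_comp, commaTgt, commaObj.hom_mk, A.comp_cmp]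
  refine A.cmp_congr _ ?_ ?_
  · rw [← Category.assoc, ← commaArr.right_comp, Category.comp_id]
  · rw [← commaArr.hom_comp, Category.comp_id]

lemma right_commaTgt (δ : X ⟶ R.commaArr) :
    commaObj.right (δ ≫ R.commaTgt) = commaArr.right δ ≫ B.tgt := by
  rw [commaObj.right_comp, commaTgt, commaObj.right_mk, ← Category.assoc, ← commaArr.right_comp,
    Category.comp_id]

lemma hom_commaIdent (d : X ⟶ R.commaObj) : commaArr.hom (d ≫ R.commaIdent) = commaObj.hom d := by
  rw [commaArr.hom_comp, commaIdent, commaArr.hom_mk, ← commaObj.hom_comp, Category.comp_id]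

lemma right_commaIdent (d : X ⟶ R.commaObj) :
    commaArr.right (d ≫ R.commaIdent) = commaObj.right d ≫ B.ident := by
  rw [commaArr.right_comp, commaIdent, commaArr.right_mk, ← Category.assoc, ← commaObj.right_comp,
    Category.comp_id]

lemma right_src_eq_tgt {ε δ : X ⟶ R.commaArr} (w : ε ≫ R.commaSrc = δ ≫ R.commaTgt) :
    commaArr.right ε ≫ B.src = commaArr.right δ ≫ B.tgt := by
  rw [← right_commaSrc, ← right_commaTgt, w]

/-- Composition of arrows of the comma category at stage `X`. -/
def commaCmp (ε δ : X ⟶ R.commaArr) (w : ε ≫ R.commaSrc = δ ≫ R.commaTgt) : X ⟶ R.commaArr :=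
  commaArr.mk (commaArr.hom δ) (B.cmp (commaArr.right ε) (commaArr.right δ) (right_src_eq_tgt w))
    (commaArr.hom_src δ) (by rw [B.cmp_src, commaArr.hom_tgt])

lemma hom_commaCmp (ε δ : X ⟶ R.commaArr) (w : ε ≫ R.commaSrc = δ ≫ R.commaTgt) :
    commaArr.hom (commaCmp ε δ w) = commaArr.hom δ :=
  commaArr.hom_mk _ _ _ _

lemma right_commaCmp (ε δ : X ⟶ R.commaArr) (w : ε ≫ R.commaSrc = δ ≫ R.commaTgt) :
    commaArr.right (commaCmp ε δ w) =
      B.cmp (commaArr.right ε) (commaArr.right δ) (right_src_eq_tgt w) :=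
  commaArr.right_mk _ _ _ _

lemma comp_commaCmp {Y : Over A.Obj} (u : Y ⟶ X) (ε δ : X ⟶ R.commaArr)
    (w : ε ≫ R.commaSrc = δ ≫ R.commaTgt) :
    u ≫ commaCmp ε δ w =
      commaCmp (u ≫ ε) (u ≫ δ) (by rw [Category.assoc, w, Category.assoc]) := by
  refine commaArr.ext ?_ ?_
  · rw [commaArr.hom_comp, hom_commaCmp, hom_commaCmp, commaArr.hom_comp]
  · rw [commaArr.right_comp, right_commaCmp, right_commaCmp, B.comp_cmp]
    exact B.cmp_congr _ (commaArr.right_comp _ _).symm (commaArr.right_comp _ _).symm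

lemma lift_commaCmp (ε δ : X ⟶ R.commaArr) (w : ε ≫ R.commaSrc = δ ≫ R.commaTgt) :
    pullback.lift ε δ w ≫ commaCmp (pullback.fst R.commaSrc R.commaTgt)
      (pullback.snd R.commaSrc R.commaTgt) pullback.condition = commaCmp ε δ w := by
  rw [comp_commaCmp]
  congr 1
  · exact pullback.lift_fst _ _ _
  · exact pullback.lift_snd _ _ _

lemma commaCmp_src (ε δ : X ⟶ R.commaArr) (w : ε ≫ R.commaSrc = δ ≫ R.commaTgt) :
    commaCmp ε δ w ≫ R.commaSrc = δ ≫ R.commaSrc := by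
  refine commaObj.ext ?_ ?_
  · rw [hom_commaSrc, hom_commaSrc, hom_commaCmp]
  · rw [right_commaSrc, right_commaSrc, right_commaCmp, B.cmp_src]

lemma commaCmp_tgt (ε δ : X ⟶ R.commaArr) (w : ε ≫ R.commaSrc = δ ≫ R.commaTgt) :
    commaCmp ε δ w ≫ R.commaTgt = ε ≫ R.commaTgt := by
  refine commaObj.ext ?_ ?_
  · have h := congrArg commaObj.hom w
    rw [hom_commaSrc, hom_commaTgt] at h
    have e : commaArr.right (commaCmp ε δ w) ≫ R.arr = _ :=
      (congrArg (· ≫ R.arr) (right_commaCmp ε δ w)).trans (R.cmp_arr _ _ (right_src_eq_tgt w))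
    rw [hom_commaTgt, hom_commaTgt, A.cmp_congr _ rfl h, A.cmp_congr _ e (hom_commaCmp ε δ w),
      A.cmp_assoc]
  · rw [right_commaTgt, right_commaTgt, right_commaCmp, B.cmp_tgt]

end

/-- The comma category `(a ↓ R)` for the generic object `a` of `A`: an internal category in the
slice over `A.Obj`. -/
def comma : InternalCategory (Over A.Obj) where
  Obj := R.commaObj
  Arr := R.commaArr
  src := R.commaSrc
  tgt := R.commaTgt
  ident := R.commaIdent
  comp := commaCmp (pullback.fst _ _) (pullback.snd _ _) pullback.condition
  ident_src := by
    refine commaObj.ext ?_ ?_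
    · rw [hom_commaSrc, ← Category.id_comp R.commaIdent, hom_commaIdent]
    · rw [right_commaSrc, ← Category.id_comp R.commaIdent, right_commaIdent, Category.assoc,
        B.ident_src, Category.comp_id]
  ident_tgt := by
    refine commaObj.ext ?_ ?_
    · have e : commaArr.right (𝟙 _ ≫ R.commaIdent) ≫ R.arr =
          (commaObj.right (𝟙 _) ≫ R.obj) ≫ A.ident := by
        rw [right_commaIdent, Category.assoc, R.ident_arr, Category.assoc]
      rw [← Category.id_comp R.commaIdent, hom_commaTgt, A.cmp_congr _ e (hom_commaIdent _),
        A.ident_cmp_of_eq]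
    · rw [right_commaTgt, ← Category.id_comp R.commaIdent, right_commaIdent, Category.assoc,
        B.ident_tgt, Category.comp_id]
  comp_src := commaCmp_src _ _ _
  comp_tgt := commaCmp_tgt _ _ _
  assoc h g f w w' := by
    simp only [lift_commaCmp]
    refine commaArr.ext ?_ ?_
    · simp only [hom_commaCmp]
    · simp only [right_commaCmp]
      rw [B.cmp_assoc]
  comp_ident f := by
    rw [lift_commaCmp]
    have e : commaArr.right (f ≫ R.commaSrc ≫ R.commaIdent) =
        (commaArr.right f ≫ B.src) ≫ B.ident := by
      rw [← Category.assoc, right_commaIdent, right_commaSrc]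
    refine commaArr.ext ?_ ?_
    · rw [hom_commaCmp, ← Category.assoc, hom_commaIdent, hom_commaSrc]
    · rw [right_commaCmp, B.cmp_congr _ rfl e, B.cmp_ident_of_eq]
  ident_comp f := by
    rw [lift_commaCmp]
    have e : commaArr.right (f ≫ R.commaTgt ≫ R.commaIdent) =
        (commaArr.right f ≫ B.tgt) ≫ B.ident := by
      rw [← Category.assoc, right_commaIdent, right_commaTgt]
    refine commaArr.ext ?_ ?_
    · rw [hom_commaCmp]
    · rw [right_commaCmp, B.cmp_congr _ e rfl, B.ident_cmp_of_eq]

lemma comma_cmp {X : Over A.Obj} (ε δ : X ⟶ R.comma.Arr)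
    (w : ε ≫ R.comma.src = δ ≫ R.comma.tgt) : R.comma.cmp ε δ w = commaCmp ε δ w :=
  lift_commaCmp ε δ w

/-- The object part of the projection `(a ↓ R) ⟶ B`. -/
def commaProjObj : R.commaObj ⟶ (B.map (Over.star A.Obj)).Obj :=
  (B.objEquiv _).symm (commaObj.right (𝟙 _))

/-- The arrow part of the projection `(a ↓ R) ⟶ B`. -/
def commaProjArr : R.commaArr ⟶ (B.map (Over.star A.Obj)).Arr :=
  (B.arrEquiv _).symm (commaArr.right (𝟙 _))

section

variable {R} {X : Over A.Obj}

lemma objEquiv_commaProjObj (d : X ⟶ R.commaObj) :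
    B.objEquiv X (d ≫ R.commaProjObj) = commaObj.right d := by
  rw [B.objEquiv_comp, commaProjObj, Equiv.apply_symm_apply, ← commaObj.right_comp,
    Category.comp_id]

lemma arrEquiv_commaProjArr (δ : X ⟶ R.commaArr) :
    B.arrEquiv X (δ ≫ R.commaProjArr) = commaArr.right δ := by
  rw [B.arrEquiv_comp, commaProjArr, Equiv.apply_symm_apply, ← commaArr.right_comp,
    Category.comp_id]

lemma commaProj_src (δ : X ⟶ R.commaArr) :
    (δ ≫ R.commaProjArr) ≫ (B.map (Over.star A.Obj)).src = (δ ≫ R.commaSrc) ≫ R.commaProjObj := by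
  apply (B.objEquiv _).injective
  rw [B.objEquiv_src, arrEquiv_commaProjArr, objEquiv_commaProjObj, right_commaSrc]

lemma commaProj_tgt (δ : X ⟶ R.commaArr) :
    (δ ≫ R.commaProjArr) ≫ (B.map (Over.star A.Obj)).tgt = (δ ≫ R.commaTgt) ≫ R.commaProjObj := by
  apply (B.objEquiv _).injective
  rw [B.objEquiv_tgt, arrEquiv_commaProjArr, objEquiv_commaProjObj, right_commaTgt]

lemma commaProj_ident (d : X ⟶ R.commaObj) :
    (d ≫ R.commaIdent) ≫ R.commaProjArr =
      (d ≫ R.commaProjObj) ≫ (B.map (Over.star A.Obj)).ident := by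
  apply (B.arrEquiv _).injective
  rw [arrEquiv_commaProjArr, right_commaIdent, B.arrEquiv_ident, objEquiv_commaProjObj]

lemma commaCmp_projArr (ε δ : X ⟶ R.commaArr) (w : ε ≫ R.commaSrc = δ ≫ R.commaTgt) :
    commaCmp ε δ w ≫ R.commaProjArr =
      (B.map (Over.star A.Obj)).cmp (ε ≫ R.commaProjArr) (δ ≫ R.commaProjArr)
        (by rw [commaProj_src, commaProj_tgt, w]) := by
  apply (B.arrEquiv _).injective
  rw [arrEquiv_commaProjArr, B.arrEquiv_cmp, right_commaCmp]
  exact B.cmp_congr _ (arrEquiv_commaProjArr _).symm (arrEquiv_commaProjArr _).symm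

end

/-- The projection `(a ↓ R) ⟶ B` for the generic object `a` of `A`. -/
def commaProj : InternalFunctor R.comma (B.map (Over.star A.Obj)) where
  obj := R.commaProjObj
  arr := R.commaProjArr
  arr_src := by
    have := commaProj_src (𝟙 R.commaArr)
    rwa [Category.id_comp, Category.id_comp] at this
  arr_tgt := by
    have := commaProj_tgt (𝟙 R.commaArr)
    rwa [Category.id_comp, Category.id_comp] at this
  ident_arr := by
    have := commaProj_ident (𝟙 R.commaObj)
    rwa [Category.id_comp, Category.id_comp] at this
  cmp_arr ε δ w := (congrArg (· ≫ R.commaProjArr) (R.comma_cmp ε δ w)).trans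
    (commaCmp_projArr ε δ w)

end InternalFunctor

/-! ### Adjunctions from universal arrows -/

/-- For each object `a` of `A`, at each stage, a universal arrow `unit a : a ⟶ R (obj a)` from `a`
to `R`: an arrow `f : a ⟶ R b` factors uniquely as the composite of `unit a` and `R g`, where
`g : obj a ⟶ b` is `lift f b`. By the Yoneda lemma it suffices to give `obj` and `unit` at the
generic object of `A`, which lives at the stage `A.Obj`. -/
structure InternalUniversalArrows {C : Type u} [Category.{v} C] [HasFiniteLimits C]
    {A B : InternalCategory C} (R : InternalFunctor B A) where
  obj : A.Obj ⟶ B.Obj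
  unit : A.Obj ⟶ A.Arr
  unit_src : unit ≫ A.src = 𝟙 _
  unit_tgt : unit ≫ A.tgt = obj ≫ R.obj
  lift : ∀ {X : C} (f : X ⟶ A.Arr) (b : X ⟶ B.Obj), f ≫ A.tgt = b ≫ R.obj → (X ⟶ B.Arr)
  lift_src : ∀ {X : C} (f : X ⟶ A.Arr) (b : X ⟶ B.Obj) (w : f ≫ A.tgt = b ≫ R.obj),
    lift f b w ≫ B.src = (f ≫ A.src) ≫ obj
  lift_tgt : ∀ {X : C} (f : X ⟶ A.Arr) (b : X ⟶ B.Obj) (w : f ≫ A.tgt = b ≫ R.obj),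
    lift f b w ≫ B.tgt = b
  lift_fac : ∀ {X : C} (f : X ⟶ A.Arr) (b : X ⟶ B.Obj) (w : f ≫ A.tgt = b ≫ R.obj),
    A.cmp (lift f b w ≫ R.arr) ((f ≫ A.src) ≫ unit)
      (by rw [Category.assoc, R.arr_src, ← Category.assoc, lift_src, Category.assoc _ unit,
        unit_tgt, Category.assoc]) = f
  hom_ext : ∀ {X : C} (a : X ⟶ A.Obj) (g g' : X ⟶ B.Arr) (hg : g ≫ B.src = a ≫ obj)
    (hg' : g' ≫ B.src = a ≫ obj) (_ : g ≫ B.tgt = g' ≫ B.tgt)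
    (_ : A.cmp (g ≫ R.arr) (a ≫ unit)
        (by rw [Category.assoc, R.arr_src, ← Category.assoc, hg, Category.assoc a unit, unit_tgt,
          Category.assoc]) =
      A.cmp (g' ≫ R.arr) (a ≫ unit)
        (by rw [Category.assoc, R.arr_src, ← Category.assoc, hg', Category.assoc a unit, unit_tgt,
          Category.assoc])), g = g'

namespace InternalUniversalArrows

variable {C : Type u} [Category.{v} C] [HasFiniteLimits C] {A B : InternalCategory C}
  {R : InternalFunctor B A} (U : InternalUniversalArrows R)

lemma src_eq_tgt {X : C} {g : X ⟶ B.Arr} {a : X ⟶ A.Obj} (hg : g ≫ B.src = a ≫ U.obj) :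
    (g ≫ R.arr) ≫ A.src = (a ≫ U.unit) ≫ A.tgt := by
  rw [Category.assoc, R.arr_src, ← Category.assoc, hg, Category.assoc a U.unit, U.unit_tgt,
    Category.assoc]

lemma comp_unit_src {X : C} (a : X ⟶ A.Obj) : (a ≫ U.unit) ≫ A.src = a := by
  rw [Category.assoc, U.unit_src, Category.comp_id]

lemma comp_unit_tgt {X : C} (a : X ⟶ A.Obj) : (a ≫ U.unit) ≫ A.tgt = (a ≫ U.obj) ≫ R.obj := by
  rw [Category.assoc, U.unit_tgt, Category.assoc]

lemma ident_unit {X : C} (a : X ⟶ A.Obj)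
    (w : (((a ≫ U.obj) ≫ B.ident) ≫ R.arr) ≫ A.src = (a ≫ U.unit) ≫ A.tgt) :
    A.cmp (((a ≫ U.obj) ≫ B.ident) ≫ R.arr) (a ≫ U.unit) w = a ≫ U.unit := by
  have e : ((a ≫ U.obj) ≫ B.ident) ≫ R.arr = ((a ≫ U.obj) ≫ R.obj) ≫ A.ident := by
    rw [Category.assoc, R.ident_arr, Category.assoc (a ≫ U.obj)]
  rw [A.cmp_congr _ e rfl, A.ident_cmp_of_eq]

/-- Composing with the unit turns composition in `B` into composition with an arrow in the image
of `R`. -/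
lemma cmp_unit {X : C} (g f : X ⟶ B.Arr) (w : g ≫ B.src = f ≫ B.tgt) (a : X ⟶ A.Obj)
    (hf : f ≫ B.src = a ≫ U.obj) :
    A.cmp (B.cmp g f w ≫ R.arr) (a ≫ U.unit) (U.src_eq_tgt (by rw [B.cmp_src, hf])) =
      A.cmp (g ≫ R.arr) (A.cmp (f ≫ R.arr) (a ≫ U.unit) (U.src_eq_tgt hf))
        (by rw [A.cmp_tgt, Category.assoc, R.arr_src, Category.assoc, R.arr_tgt, ← Category.assoc,
          w, Category.assoc]) := by
  rw [A.cmp_congr _ (R.cmp_arr g f w) rfl, A.cmp_assoc]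

lemma unit_tgt_src : (A.tgt ≫ U.unit) ≫ A.src = 𝟙 A.Arr ≫ A.tgt := by
  rw [U.comp_unit_src, Category.id_comp]

/-- The action of the left adjoint on the generic arrow. -/
def arr : A.Arr ⟶ B.Arr :=
  U.lift (A.cmp (A.tgt ≫ U.unit) (𝟙 _) U.unit_tgt_src) (A.tgt ≫ U.obj)
    (by rw [A.cmp_tgt, U.comp_unit_tgt])

lemma comp_arr_src {X : C} (f : X ⟶ A.Arr) : (f ≫ U.arr) ≫ B.src = (f ≫ A.src) ≫ U.obj := by
  rw [Category.assoc, arr, U.lift_src, A.cmp_src, Category.id_comp, Category.assoc]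

lemma comp_arr_tgt {X : C} (f : X ⟶ A.Arr) : (f ≫ U.arr) ≫ B.tgt = (f ≫ A.tgt) ≫ U.obj := by
  rw [Category.assoc, arr, U.lift_tgt, Category.assoc]

/-- Naturality of the unit with respect to an arrow `f` of `A` at an arbitrary stage. -/
lemma arr_fac {X : C} (f : X ⟶ A.Arr) :
    A.cmp ((f ≫ U.arr) ≫ R.arr) ((f ≫ A.src) ≫ U.unit) (U.src_eq_tgt (U.comp_arr_src f)) =
      A.cmp ((f ≫ A.tgt) ≫ U.unit) f (U.comp_unit_src _) := by
  have h := congrArg (f ≫ ·) (U.lift_fac (A.cmp (A.tgt ≫ U.unit) (𝟙 _) U.unit_tgt_src)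
    (A.tgt ≫ U.obj) (by rw [A.cmp_tgt, U.comp_unit_tgt]))
  simp only [A.comp_cmp] at h
  refine (A.cmp_congr _ (Category.assoc _ _ _) ?_).trans (h.trans (A.cmp_congr _ ?_ ?_))
  · rw [A.cmp_src, Category.id_comp, Category.assoc]
  · rw [Category.assoc]
  · rw [Category.comp_id]

/-- The left adjoint determined by universal arrows. -/
def leftAdjoint : InternalFunctor A B where
  obj := U.obj
  arr := U.arr
  arr_src := by simpa using U.comp_arr_src (𝟙 _)
  arr_tgt := by simpa using U.comp_arr_tgt (𝟙 _)
  ident_arr := by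
    have h₁ : (A.ident ≫ U.arr) ≫ B.src = 𝟙 _ ≫ U.obj := by
      rw [U.comp_arr_src, A.ident_src]
    have h₂ : (U.obj ≫ B.ident) ≫ B.src = 𝟙 _ ≫ U.obj := by
      rw [Category.assoc, B.ident_src, Category.comp_id, Category.id_comp]
    refine U.hom_ext (𝟙 _) _ _ h₁ h₂ ?_ ?_
    · rw [U.comp_arr_tgt, A.ident_tgt, Category.assoc, B.ident_tgt, Category.comp_id,
        Category.id_comp]
    · have e₁ := U.arr_fac A.ident
      rw [A.cmp_congr _ rfl (congrArg (· ≫ U.unit) A.ident_src)] at e₁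
      rw [e₁, A.cmp_congr (g' := (𝟙 _ ≫ U.unit)) (f' := 𝟙 _ ≫ A.ident) _
          (congrArg (· ≫ U.unit) A.ident_tgt) (Category.id_comp _).symm, A.cmp_ident_of_eq,
        A.cmp_congr (f := 𝟙 _ ≫ U.unit) _
          (congrArg (fun x => (x ≫ B.ident) ≫ R.arr) (Category.id_comp U.obj).symm) rfl,
        U.ident_unit]
  cmp_arr {X} g f w := by
    have hw : (g ≫ U.arr) ≫ B.src = (f ≫ U.arr) ≫ B.tgt := by
      rw [U.comp_arr_src, U.comp_arr_tgt, w]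
    refine U.hom_ext (f ≫ A.src) _ _ (by rw [U.comp_arr_src, A.cmp_src])
      (by rw [B.cmp_src, U.comp_arr_src]) (by rw [U.comp_arr_tgt, A.cmp_tgt, B.cmp_tgt,
        U.comp_arr_tgt]) ?_
    have e := U.arr_fac (A.cmp g f w)
    rw [A.cmp_congr _ rfl (congrArg (· ≫ U.unit) (A.cmp_src g f w))] at e
    have e' := U.arr_fac g
    rw [A.cmp_congr _ rfl (congrArg (· ≫ U.unit) w)] at e'
    rw [e, U.cmp_unit _ _ hw _ (U.comp_arr_src f), A.cmp_congr _ rfl (U.arr_fac f),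
      A.cmp_assoc ((g ≫ U.arr) ≫ R.arr), A.cmp_congr _ e' rfl,
      A.cmp_congr _ (congrArg (· ≫ U.unit) (A.cmp_tgt g f w)) rfl,
      A.cmp_assoc]
    exact U.src_eq_tgt (by rw [U.comp_arr_src, w])

/-- The counit at the generic object of `B`. -/
def counitApp : B.Obj ⟶ B.Arr :=
  U.lift (R.obj ≫ A.ident) (𝟙 _) (by rw [Category.assoc, A.ident_tgt, Category.comp_id,
    Category.id_comp])

lemma comp_counitApp_src {X : C} (b : X ⟶ B.Obj) :
    (b ≫ U.counitApp) ≫ B.src = (b ≫ R.obj) ≫ U.obj := by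
  rw [Category.assoc, counitApp, U.lift_src, Category.assoc R.obj, A.ident_src, Category.comp_id,
    Category.assoc]

lemma comp_counitApp_tgt {X : C} (b : X ⟶ B.Obj) : (b ≫ U.counitApp) ≫ B.tgt = b := by
  rw [Category.assoc, counitApp, U.lift_tgt, Category.comp_id]

/-- The triangle identity `(R ε) (η R) = Id` at an object `b` of `B`. -/
lemma counitApp_fac {X : C} (b : X ⟶ B.Obj) :
    A.cmp ((b ≫ U.counitApp) ≫ R.arr) ((b ≫ R.obj) ≫ U.unit)
      (U.src_eq_tgt (U.comp_counitApp_src b)) = (b ≫ R.obj) ≫ A.ident := by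
  have h := congrArg (b ≫ ·) (U.lift_fac (R.obj ≫ A.ident) (𝟙 _)
    (by rw [Category.assoc, A.ident_tgt, Category.comp_id, Category.id_comp]))
  simp only [A.comp_cmp] at h
  refine (A.cmp_congr _ (Category.assoc _ _ _) ?_).trans (h.trans (Category.assoc _ _ _).symm)
  rw [Category.assoc R.obj, A.ident_src, Category.comp_id, Category.assoc]

/-- Universal arrows from each object of `A` to `R` give an adjunction. -/
def adjunction : InternalAdjunction U.leftAdjoint R where
  unit :=
    { app := U.unit
      app_src := U.unit_src
      app_tgt := U.unit_tgt
      naturality := by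
        refine Eq.trans (A.cmp_congr _ ?_ ?_) ((U.arr_fac (𝟙 _)).trans (A.cmp_congr _ ?_ rfl))
        · rw [Category.id_comp]; rfl
        · rw [Category.id_comp]
        · rw [Category.id_comp] }
  counit :=
    { app := U.counitApp
      app_src := by
        have h := U.comp_counitApp_src (𝟙 _)
        simp only [Category.id_comp] at h
        exact h
      app_tgt := by
        have h := U.comp_counitApp_tgt (𝟙 _)
        simp only [Category.id_comp] at h
        exact h
      naturality := by
        have w₁ : 𝟙 B.Arr ≫ B.src = (B.src ≫ U.counitApp) ≫ B.tgt := by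
          rw [U.comp_counitApp_tgt, Category.id_comp]
        have w₂ : (B.tgt ≫ U.counitApp) ≫ B.src = (R.arr ≫ U.arr) ≫ B.tgt := by
          rw [U.comp_counitApp_src, U.comp_arr_tgt, R.arr_tgt]
        have s₁ := U.comp_counitApp_src B.src
        have s₂ : (R.arr ≫ U.arr) ≫ B.src = (B.src ≫ R.obj) ≫ U.obj := by
          rw [U.comp_arr_src, R.arr_src]
        change B.cmp (𝟙 B.Arr) (B.src ≫ U.counitApp) w₁ =
          B.cmp (B.tgt ≫ U.counitApp) (R.arr ≫ U.arr) w₂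
        refine U.hom_ext (B.src ≫ R.obj) _ _ (by rw [B.cmp_src, s₁]) (by rw [B.cmp_src, s₂])
          (by rw [B.cmp_tgt, B.cmp_tgt, U.comp_counitApp_tgt, Category.id_comp]) ?_
        have e := U.arr_fac R.arr
        rw [A.cmp_congr _ rfl (congrArg (· ≫ U.unit) R.arr_src)] at e
        have e' := U.counitApp_fac B.tgt
        rw [A.cmp_congr _ rfl (congrArg (· ≫ U.unit) R.arr_tgt.symm)] at e'
        rw [U.cmp_unit _ _ w₁ _ s₁, A.cmp_congr _ rfl (U.counitApp_fac B.src), A.cmp_ident_of_eq,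
          U.cmp_unit _ _ w₂ _ s₂, A.cmp_congr _ rfl e, A.cmp_assoc, A.cmp_congr _ e' rfl,
          A.ident_cmp_of_eq, Category.id_comp]
        exact U.src_eq_tgt (by rw [U.comp_counitApp_src, R.arr_tgt]) }
  left_triangle := by
    have w : (U.obj ≫ U.counitApp) ≫ B.src = (U.unit ≫ U.arr) ≫ B.tgt := by
      rw [U.comp_counitApp_src, U.comp_arr_tgt, U.unit_tgt]
    have s : (U.unit ≫ U.arr) ≫ B.src = 𝟙 _ ≫ U.obj := by rw [U.comp_arr_src, U.unit_src]
    have s' : (U.obj ≫ B.ident) ≫ B.src = 𝟙 _ ≫ U.obj := by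
      rw [Category.assoc, B.ident_src, Category.comp_id, Category.id_comp]
    change B.cmp (U.obj ≫ U.counitApp) (U.unit ≫ U.arr) w = U.obj ≫ B.ident
    refine U.hom_ext (𝟙 _) _ _ (by rw [B.cmp_src, s]) s' ?_ ?_
    · rw [B.cmp_tgt, U.comp_counitApp_tgt, Category.assoc, B.ident_tgt, Category.comp_id]
    · have e := U.arr_fac U.unit
      rw [A.cmp_congr _ rfl (congrArg (· ≫ U.unit) U.unit_src)] at e
      have e' := U.counitApp_fac U.obj
      rw [A.cmp_congr _ rfl (congrArg (· ≫ U.unit) U.unit_tgt.symm)] at e'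
      rw [U.cmp_unit _ _ w _ s, A.cmp_congr _ rfl e, A.cmp_assoc, A.cmp_congr _ e' rfl,
        A.ident_cmp_of_eq,
        A.cmp_congr (f := 𝟙 _ ≫ U.unit) _
          (congrArg (fun x => (x ≫ B.ident) ≫ R.arr) (Category.id_comp U.obj).symm) rfl,
        U.ident_unit, Category.id_comp]
      exact U.src_eq_tgt (by rw [U.comp_counitApp_src, U.unit_tgt])
  right_triangle := by
    have h := U.counitApp_fac (𝟙 _)
    simp only [Category.id_comp] at h
    exact h

end InternalUniversalArrows

/-! ### The limit of the comma category as a universal arrow -/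

namespace InternalFunctor

variable {C : Type u} [Category.{v} C] [HasFiniteLimits C] {A B : InternalCategory C}
  (R : InternalFunctor B A)

namespace commaCone

variable {R} (c : InternalCone R.commaProj)

/-- The vertex of a cone over the projection `(a ↓ R) ⟶ B`, as a family of objects of `B` indexed
by `a`. -/
def vertexObj : A.Obj ⟶ B.Obj :=
  B.objEquiv (Over.mk (𝟙 A.Obj)) (c.vertexAt _)

/-- The leg of a cone over the projection `(a ↓ R) ⟶ B` at an object of `(a ↓ R)`. -/
def leg {X : Over A.Obj} (d : X ⟶ R.commaObj) : X.left ⟶ B.Arr :=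
  B.arrEquiv X (d ≫ c.leg.app)

/-- The structure map of an object of the slice over `I`, as a map to the terminal object. -/
def toOne {C : Type u} [Category.{v} C] {I : C} (X : Over I) : X ⟶ Over.mk (𝟙 I) :=
  Over.homMk X.hom (Category.comp_id _)

lemma objEquiv_vertexAt (X : Over A.Obj) : B.objEquiv X (c.vertexAt X) = X.hom ≫ vertexObj c := by
  rw [← c.comp_vertexAt (toOne X), B.objEquiv_comp]
  rfl

lemma leg_comp {X Y : Over A.Obj} (u : Y ⟶ X) (d : X ⟶ R.commaObj) :
    leg c (u ≫ d) = u.left ≫ leg c d :=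
  (congrArg (B.arrEquiv Y) (Category.assoc u d c.leg.app)).trans (B.arrEquiv_comp _ _)

lemma leg_src {X : Over A.Obj} (d : X ⟶ R.commaObj) :
    leg c d ≫ B.src = X.hom ≫ vertexObj c := by
  rw [leg, ← B.objEquiv_src, ← objEquiv_vertexAt]
  exact congrArg (B.objEquiv X) (c.leg_app_src d)

lemma leg_tgt {X : Over A.Obj} (d : X ⟶ R.commaObj) : leg c d ≫ B.tgt = commaObj.right d := by
  rw [leg, ← B.objEquiv_tgt, ← objEquiv_commaProjObj]
  exact congrArg (B.objEquiv X) (c.leg_app_tgt d)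

lemma cmp_leg {X : Over A.Obj} (δ : X ⟶ R.commaArr) :
    B.cmp (commaArr.right δ) (leg c (δ ≫ R.commaSrc)) (by rw [leg_tgt, right_commaSrc]) =
      leg c (δ ≫ R.commaTgt) := by
  have h := congrArg (B.arrEquiv X) (c.cmp_leg δ)
  rw [B.arrEquiv_cmp] at h
  exact (B.cmp_congr _ (arrEquiv_commaProjArr δ).symm rfl).trans h

/-- The image under `R` of a leg of a cone over the projection `(a ↓ R) ⟶ B`. -/
lemma arrEquiv_postcomp_leg {X : Over A.Obj} (d : X ⟶ R.commaObj) :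
    A.arrEquiv X (d ≫ (c.postcomp (R.map (Over.star A.Obj))).leg.app) = leg c d ≫ R.arr :=
  (congrArg (A.arrEquiv X) (Category.assoc _ _ _).symm).trans
    (InternalCategory.arrEquiv_map R _)

lemma objEquiv_postcomp_vertexAt (X : Over A.Obj) :
    A.objEquiv X ((c.postcomp (R.map (Over.star A.Obj))).vertexAt X) =
      X.hom ≫ vertexObj c ≫ R.obj := by
  refine (congrArg (A.objEquiv X) (Category.assoc _ _ _).symm).trans
    ((InternalCategory.objEquiv_map R _).trans ?_)
  rw [← Category.assoc, ← objEquiv_vertexAt]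
  rfl

/-- The tautological cone from `a` to the composite of `R` with the projection `(a ↓ R) ⟶ B`,
for the generic object `a` of `A`: its leg at `(f, b)` is `f : a ⟶ R b`. -/
def tautological : InternalCone.Staged (R.commaProj.comp (R.map (Over.star A.Obj)))
    (Over.mk (𝟙 A.Obj)) where
  vertex := (A.objEquiv (Over.mk (𝟙 A.Obj))).symm (𝟙 A.Obj)
  leg {X} _ d := (A.arrEquiv X).symm (commaObj.hom d)
  comp_leg {X Y} u _ d := by
    apply (A.arrEquiv _).injective
    rw [A.arrEquiv_comp, Equiv.apply_symm_apply, Equiv.apply_symm_apply]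
    exact (commaObj.hom_comp u d).symm
  leg_src {X} j d := by
    apply (A.objEquiv _).injective
    rw [A.objEquiv_src, A.objEquiv_comp, Equiv.apply_symm_apply, Equiv.apply_symm_apply]
    exact (commaObj.hom_src d).trans (Over.w j).symm
  leg_tgt {X} j d := by
    apply (A.objEquiv _).injective
    rw [A.objEquiv_tgt, Equiv.apply_symm_apply, comp_obj, ← Category.assoc,
      InternalCategory.objEquiv_map]
    exact (commaObj.hom_tgt d).trans (congrArg (· ≫ R.obj) (objEquiv_commaProjObj d).symm)
  naturality {X} j δ := by
    apply (A.arrEquiv _).injective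
    rw [A.arrEquiv_cmp]
    refine (A.cmp_congr _ ?_ ((Equiv.apply_symm_apply _ _).trans (hom_commaSrc δ))).trans
      ((hom_commaTgt δ).symm.trans (Equiv.apply_symm_apply _ _).symm)
    rw [comp_arr, ← Category.assoc, InternalCategory.arrEquiv_map]
    exact congrArg (· ≫ R.arr) (arrEquiv_commaProjArr δ)

/-- `η` is an arrow from `a` to the image under `R` of the vertex of `c`, for the generic object
`a` of `A`, through which each arrow `f : a ⟶ R b` factors by the image of the leg at `(f, b)`. -/
structure IsComparison (η : A.Obj ⟶ A.Arr) : Prop where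
  src : η ≫ A.src = 𝟙 _
  tgt : η ≫ A.tgt = vertexObj c ≫ R.obj
  fac : ∀ {X : Over A.Obj} (d : X ⟶ R.commaObj),
    A.cmp (leg c d ≫ R.arr) (X.hom ≫ η)
      (by rw [Category.assoc, R.arr_src, ← Category.assoc, leg_src, Category.assoc _ η, tgt,
        Category.assoc]) = commaObj.hom d

/-- If `R` sends `c` to a universal cone, then the tautological cone factors through its image. -/
lemma exists_isComparison (hc : (c.postcomp (R.map (Over.star A.Obj))).IsUniversal) :
    ∃ η, IsComparison c η := by
  obtain ⟨h, H⟩ := hc.exists_factorization tautological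
  refine ⟨A.arrEquiv _ h, ?_, ?_, fun {X} d => ?_⟩
  · rw [← A.objEquiv_src, H.src]
    exact Equiv.apply_symm_apply _ _
  · rw [← A.objEquiv_tgt, H.tgt, objEquiv_postcomp_vertexAt]
    exact Category.id_comp _
  · have := congrArg (A.arrEquiv X) (H.fac (toOne X) d)
    rw [A.arrEquiv_cmp] at this
    refine (A.cmp_congr _ (arrEquiv_postcomp_leg c d).symm ?_).trans
      (this.trans (Equiv.apply_symm_apply _ _))
    rw [A.arrEquiv_comp]
    rfl

section

variable {c} {η : A.Obj ⟶ A.Arr} (H : IsComparison c η)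

/-- The vertex of the cone, together with `η`, as an object of the comma category. -/
def unitObj : Over.mk (𝟙 A.Obj) ⟶ R.commaObj :=
  commaObj.mk η (vertexObj c) H.src H.tgt

lemma hom_toOne_unitObj (X : Over A.Obj) :
    commaObj.hom (toOne X ≫ unitObj H) = X.hom ≫ η := by
  rw [commaObj.hom_comp, unitObj, commaObj.hom_mk]
  rfl

lemma right_toOne_unitObj (X : Over A.Obj) :
    commaObj.right (toOne X ≫ unitObj H) = X.hom ≫ vertexObj c := by
  rw [commaObj.right_comp, unitObj, commaObj.right_mk]
  rfl

/-- An arrow `g` out of the vertex is an arrow of the comma category with source the vertex. -/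
def arrOfUnit {X : Over A.Obj} (g : X.left ⟶ B.Arr) (hg : g ≫ B.src = X.hom ≫ vertexObj c) :
    X ⟶ R.commaArr :=
  commaArr.mk (X.hom ≫ η) g (by rw [Category.assoc, H.src, Category.comp_id])
    (by rw [Category.assoc, H.tgt, hg, Category.assoc])

lemma right_arrOfUnit {X : Over A.Obj} (g : X.left ⟶ B.Arr)
    (hg : g ≫ B.src = X.hom ≫ vertexObj c) : commaArr.right (arrOfUnit H g hg) = g :=
  commaArr.right_mk _ _ _ _

lemma hom_arrOfUnit {X : Over A.Obj} (g : X.left ⟶ B.Arr)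
    (hg : g ≫ B.src = X.hom ≫ vertexObj c) : commaArr.hom (arrOfUnit H g hg) = X.hom ≫ η :=
  commaArr.hom_mk _ _ _ _

lemma arrOfUnit_src {X : Over A.Obj} (g : X.left ⟶ B.Arr)
    (hg : g ≫ B.src = X.hom ≫ vertexObj c) :
    arrOfUnit H g hg ≫ R.commaSrc = toOne X ≫ unitObj H := by
  refine commaObj.ext ?_ ?_
  · rw [hom_commaSrc, hom_arrOfUnit, hom_toOne_unitObj]
  · rw [right_commaSrc, right_arrOfUnit, right_toOne_unitObj, hg]

/-- The target of the arrow of the comma category given by `g` is any object `d` such that `g`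
is an arrow under `a` from `η` to `d`. -/
lemma arrOfUnit_tgt {X : Over A.Obj} (g : X.left ⟶ B.Arr)
    (hg : g ≫ B.src = X.hom ≫ vertexObj c) (d : X ⟶ R.commaObj)
    (hd : g ≫ B.tgt = commaObj.right d)
    (hd' : A.cmp (g ≫ R.arr) (X.hom ≫ η)
      (by rw [Category.assoc, R.arr_src, ← Category.assoc, hg, Category.assoc _ η, H.tgt,
        Category.assoc]) = commaObj.hom d) :
    arrOfUnit H g hg ≫ R.commaTgt = d := by
  refine commaObj.ext ?_ ?_
  · rw [hom_commaTgt, ← hd']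
    exact A.cmp_congr _ (congrArg (· ≫ R.arr) (right_arrOfUnit H g hg))
      (hom_arrOfUnit H g hg)
  · rw [right_commaTgt, right_arrOfUnit, hd]

/-- The leg of a limit cone over `(a ↓ R) ⟶ B` at its own vertex is the identity: precomposition
with it fixes every leg, since each leg is an arrow of the comma category. -/
lemma leg_unitObj (hc : c.IsUniversal) : leg c (unitObj H) = vertexObj c ≫ B.ident := by
  have e : unitObj H ≫ c.leg.app =
      c.vertexAt _ ≫ (B.map (Over.star A.Obj)).ident := by
    refine hc.hom_ext ?_ ?_ ?_ fun {X} j d => ?_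
    · apply (B.objEquiv _).injective
      rw [B.objEquiv_tgt, objEquiv_vertexAt]
      refine (leg_tgt c _).trans ?_
      exact (commaObj.right_mk _ _ _ _).trans (Category.id_comp _).symm
    · rw [Category.assoc, InternalCategory.ident_tgt, Category.comp_id]
    · rw [Category.assoc (c.vertexAt _), InternalCategory.ident_src, Category.comp_id]
      exact c.leg_app_src _
    · -- The leg at `d` is an arrow of the comma category from the vertex to `d`.
      have hj : j = toOne X := Over.OverMorphism.ext ((Category.comp_id _).symm.trans (Over.w j))
      have e₁ : j ≫ c.vertexAt (Over.mk (𝟙 A.Obj)) ≫ (B.map (Over.star A.Obj)).ident =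
          c.vertexAt X ≫ (B.map (Over.star A.Obj)).ident := by
        rw [← Category.assoc, c.comp_vertexAt]
      rw [(B.map (Over.star A.Obj)).cmp_congr _ rfl e₁, InternalCategory.cmp_ident_of_eq]
      apply (B.arrEquiv _).injective
      rw [B.arrEquiv_cmp]
      have h := cmp_leg c (arrOfUnit H (leg c d) (leg_src c d))
      refine (B.cmp_congr _ ?_ ?_).trans (h.trans ?_)
      · exact (right_arrOfUnit H _ _).symm
      · rw [hj, arrOfUnit_src, leg]
        exact congrArg _ (Category.assoc _ _ _).symm
      · rw [arrOfUnit_tgt H _ _ d (leg_tgt c d) (H.fac d)]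
        rfl
  refine (congrArg (B.arrEquiv _) e).trans (B.arrEquiv_ident _)

/-- The vertex of a limit cone over `(a ↓ R) ⟶ B` is initial in `(a ↓ R)`: an arrow out of it is
the leg at its target. -/
lemma eq_leg (hc : c.IsUniversal) {X : Over A.Obj} (g : X.left ⟶ B.Arr)
    (hg : g ≫ B.src = X.hom ≫ vertexObj c) (d : X ⟶ R.commaObj)
    (hd : g ≫ B.tgt = commaObj.right d)
    (hd' : A.cmp (g ≫ R.arr) (X.hom ≫ η)
      (by rw [Category.assoc, R.arr_src, ← Category.assoc, hg, Category.assoc _ η, H.tgt,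
        Category.assoc]) = commaObj.hom d) : g = leg c d := by
  have h := cmp_leg c (arrOfUnit H g hg)
  have e : leg c (arrOfUnit H g hg ≫ R.commaSrc) = (X.hom ≫ vertexObj c) ≫ B.ident := by
    rw [arrOfUnit_src, leg_comp, leg_unitObj H hc, Category.assoc]
    rfl
  rw [arrOfUnit_tgt H g hg d hd hd', B.cmp_congr _ (right_arrOfUnit H g hg) e,
    B.cmp_ident_of_eq] at h
  exact h

/-- The limits of the projections `(a ↓ R) ⟶ B` are universal arrows to `R`. -/
def universalArrows (hc : c.IsUniversal) : InternalUniversalArrows R where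
  obj := vertexObj c
  unit := η
  unit_src := H.src
  unit_tgt := H.tgt
  lift f b w := leg c (X := Over.mk (f ≫ A.src)) (commaObj.mk f b rfl w)
  lift_src f b w := leg_src c _
  lift_tgt f b w := (leg_tgt c _).trans (commaObj.right_mk _ _ _ _)
  lift_fac f b w := (H.fac _).trans (commaObj.hom_mk _ _ _ _)
  hom_ext {X} a g g' hg hg' h h' := by
    have w : (g' ≫ R.arr) ≫ A.src = (a ≫ η) ≫ A.tgt := by
      rw [Category.assoc, R.arr_src, ← Category.assoc, hg', Category.assoc a η, H.tgt,
        Category.assoc]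
    have hs : A.cmp (g' ≫ R.arr) (a ≫ η) w ≫ A.src = (Over.mk a).hom := by
      rw [A.cmp_src, Category.assoc, H.src]
      exact Category.comp_id a
    have ht : A.cmp (g' ≫ R.arr) (a ≫ η) w ≫ A.tgt = (g' ≫ B.tgt) ≫ R.obj := by
      rw [A.cmp_tgt, Category.assoc, R.arr_tgt, Category.assoc]
    obtain ⟨d, hd, hd'⟩ : ∃ d : Over.mk a ⟶ R.commaObj,
        A.cmp (g' ≫ R.arr) (a ≫ η) w = commaObj.hom d ∧ g' ≫ B.tgt = commaObj.right d :=
      ⟨commaObj.mk _ _ hs ht, (commaObj.hom_mk _ (X := Over.mk a) _ hs ht).symm,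
        (commaObj.right_mk _ (X := Over.mk a) _ hs ht).symm⟩
    have e := eq_leg H hc (X := Over.mk a) g hg d (h.trans hd') (h'.trans hd)
    have e' := eq_leg H hc (X := Over.mk a) g' hg' d hd' hd
    exact e.trans e'.symm

end

end commaCone

end InternalFunctor

end

theorem mainTheorem2 {E : Type u} [Category.{v} E] [HasFiniteLimits E]
    [IsLocallyCartesianClosed E] {A B : InternalCategory E} (hB : B.IsComplete)
    (R : InternalFunctor B A) (hR : R.IsContinuous) :
    ∃ L : InternalFunctor A B, Nonempty (InternalAdjunction L R) := by
  obtain ⟨c, hc⟩ := hB A.Obj R.comma R.commaProj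
  obtain ⟨η, H⟩ := InternalFunctor.commaCone.exists_isComparison c (hR _ _ _ c hc)
  exact ⟨_, ⟨(InternalFunctor.commaCone.universalArrows H hc).adjunction⟩⟩
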